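/- **Setting.** Let $g>0$, $\sigma>0$ and $[\![\gamma]\!]\in\mathbb R$ with $|[\![\gamma]\!]|<\sigma$. Let $\rho_0>0$ on $[0,\pi]$ be a classical ($C^2$) equilibrium profile of volume $V$, in polar coordinates, of a two-dimensional sessile drop on a horizontal line, with pressure level $P_0$. That is, $\rho_0$ solves the Euler–Lagrange system of $$E(\rho)=\tfrac g3\int_0^\pi\rho^3\sin\theta\,d\theta+\sigma\int_0^\pi\sqrt{\rho^2+\rho'^2}\,d\theta-[\![\gamma]\!](\rho(0)+\rho(\pi))$$ under the constraint $\int_0^\pi\rho^2d\theta=V$: $$g\rho_0^2\sin\theta+\sigma\frac{\rho_0}{\sqrt{\rho_0^2+\rho_0'^2}}-\sigma\,\partial_\theta\Big(\frac{\rho_0'}{\sqrt{\rho_0^2+\rho_0'^2}}\Big)=P_0\rho_0\ \text{ on }[0,\pi],$$ $$\frac{\sigma\rho_0'}{\sqrt{\rho_0^2+\rho_0'^2}}(\pi)=[\![\gamma]\!],\qquad \frac{\sigma\rho_0'}{\sqrt{\rho_0^2+\rho_0'^2}}(0)=-[\![\gamma]\!],\qquad \int_0^\pi\rho_0^2\,d\theta=V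 .$$ Let $\xi_s=\cos\theta+\frac{\rho_0'}{\rho_0}\sin\theta$ be the linearized horizontal shift. For $u,v\in H^1(0,\pi)$ let $(u,v)_{1,\Sigma}$ be the second variation at $\rho_0$ of $E$ under the volume constraint: $$\begin{aligned}(u,v)_{1,\Sigma}={}&g\int_0^\pi\rho_0uv\sin\theta\,d\theta+\sigma\int_0^\pi\frac{\rho_0^2u'v'}{(\rho_0^2+\rho_0'^2)^{3/2}}d\theta-\sigma\int_0^\pi\frac{\rho_0\rho_0'(u'v+uv')}{(\rho_0^2+\rho_0'^2)^{3/2}}d\theta\\&+\sigma\int_0^\pi\frac{\rho_0''\rho_0-\rho_0'^2-\rho_0^2}{(\rho_0^2+\rho_0'^2)^{3/2}}\,uv\,d\theta .\end{aligned}$$ A *perturbation* on $(0,T)$ is a map $\xi:(0,T)\to L^2(0,\pi)$, twice differentiable in $t$ with values in $L^2(0,\pi)$, such that $\partial_t^i\xi(t)\in H^1(0,\pi)$ for $i=0,1,2$ and all $t\in(0,T)$, and such that for all $t\in(0,T)$ the volume is conserved, $\int_0^\pi(\rho_0+\xi(t))^2d\theta=V$, and the orthogonality condition that fixes the moving pole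 holds, $\int_0^\pi\xi(t)\,\xi_s\,d\theta=0$. For it put $$a_0=\frac{-\frac12\int_0^\pi\xi^2d\theta}{\int_0^\pi\rho_0^2d\theta},\qquad a_1=\frac{-\int_0^\pi\xi\,\partial_t\xi\,d\theta}{\int_0^\pi\rho_0^2d\theta},\qquad a_2=\frac{-\int_0^\pi(\partial_t\xi)^2d\theta-\int_0^\pi\xi\,\partial_t^2\xi\,d\theta}{\int_0^\pi\rho_0^2d\theta}.$$ **Theorem.** There are constants $\delta,\delta_1,\delta_2,\delta_3,\varepsilon>0$, depending only on $g,\sigma,[\![\gamma]\!],V,P_0$ and $\rho_0$, such that the following hold. 1. For every $w\in H^1(0,\pi)$ with $\int_0^\pi w\rho_0\,d\theta=0$ and $\int_0^\pi w\xi_s\,d\theta=0$, $$(w,w)_{1,\Sigma}\ge\delta\|w\|_{H^1}^2 .$$ 2. For every $T>0$ and every perturbation $\xi$ on $(0,T)$ with $\sum_{i=0}^2\|\partial_t^i\xi(t)\|_{H^1}^2\le\varepsilon$ for all $t\in(0,T)$, and for every $t\in(0,T)$: * $(\partial_t^i\xi-a_i\rho_0,\ \xi_s)_{1,\Sigma}=0$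 for $i=0,1,2$; * $(\partial_t^i\xi-a_i\rho_0,\ \partial_t^i\xi-a_i\rho_0)_{1,\Sigma}\ge\delta\|\partial_t^i\xi-a_i\rho_0\|_{H^1}^2$ for $i=0,1,2$; * $(\xi-a_0\rho_0,\ \xi-a_0\rho_0)_{1,\Sigma}\ge\delta\|\xi\|_{H^1}^2-\|\xi\|_{L^2}^4$; * $(\partial_t\xi-a_1\rho_0,\ \partial_t\xi-a_1\rho_0)_{1,\Sigma}\ge\delta_1\|\partial_t\xi\|_{H^1}^2-\delta_2\|\xi\|_{L^2}^4$; * $(\partial_t^2\xi-a_2\rho_0,\ \partial_t^2\xi-a_2\rho_0)_{1,\Sigma}\ge\delta_1\|\partial_t^2\xi\|_{H^1}^2-\delta_2\|\partial_t\xi\|_{L^2}^4-\delta_3\|\partial_t^2\xi\|_{L^2}^2\|\xi\|_{L^2}^2$. -/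

import Mathlib

open MeasureTheory Set Filter Topology
open scoped ENNReal ContDiff

namespace SessileDrop

noncomputable section

/-! ### Sobolev space on the arc `(0, π)` -/

/-- Lebesgue measure on the interval `(0, π)` of polar angles. -/
abbrev arc : Measure ℝ := volume.restrict (Ioo 0 Real.pi)

/-- The Hilbert space `L²(0, π)`. -/
abbrev L2Arc : Type := Lp ℝ 2 arc

/-- `f'` is a weak derivative of `f` on `(0, π)`. -/
def IsWeakDeriv (f f' : ℝ → ℝ) : Prop :=
  ∀ φ : ℝ → ℝ, ContDiff ℝ ∞ φ → HasCompactSupport φ → tsupport φ ⊆ Ioo 0 Real.pi →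
    ∫ θ, f θ * deriv φ θ ∂arc = - ∫ θ, f' θ * φ θ ∂arc

/-- `f ∈ H¹(0, π)`: both `f` and a weak derivative of `f` lie in `L²(0, π)`. -/
def MemH1 (f : ℝ → ℝ) : Prop :=
  MemLp f 2 arc ∧ ∃ f' : ℝ → ℝ, MemLp f' 2 arc ∧ IsWeakDeriv f f'

open Classical in
/-- The weak derivative in `L²(0, π)` (unique up to null sets, see `IsWeakDeriv.ae_unique`);
it is `0` if there is none. -/
def weakDeriv (f : ℝ → ℝ) : ℝ → ℝ :=
  if h : ∃ f' : ℝ → ℝ, MemLp f' 2 arc ∧ IsWeakDeriv f f' then h.choose else 0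

lemma MemH1.weakDeriv_spec {f : ℝ → ℝ} (hf : MemH1 f) :
    MemLp (weakDeriv f) 2 arc ∧ IsWeakDeriv f (weakDeriv f) := by
  unfold weakDeriv
  rw [dif_pos hf.2]
  exact hf.2.choose_spec

lemma IsWeakDeriv.ae_unique {f a b : ℝ → ℝ} (ha : MemLp a 2 arc) (hb : MemLp b 2 arc)
    (h1 : IsWeakDeriv f a) (h2 : IsWeakDeriv f b) : a =ᵐ[arc] b := by
  have hai : IntegrableOn a (Ioo 0 Real.pi) := ha.integrable (by norm_num)
  have hbi : IntegrableOn b (Ioo 0 Real.pi) := hb.integrable (by norm_num)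
  have hloc : LocallyIntegrableOn (fun θ => a θ - b θ) (Ioo 0 Real.pi) :=
    (hai.sub hbi).locallyIntegrableOn
  have key := isOpen_Ioo.ae_eq_zero_of_integral_contDiff_smul_eq_zero hloc (by
    intro φ hφ hc hs
    have hφc : Continuous φ := hφ.continuous
    obtain ⟨C, hC⟩ := hc.exists_bound_of_continuous hφc
    have e1 := h1 φ hφ hc hs
    have e2 := h2 φ hφ hc hs
    have hia : Integrable (fun θ => a θ * φ θ) arc :=
      hai.mul_bdd (c := C) hφc.aestronglyMeasurable (ae_of_all _ hC)
    have hib : Integrable (fun θ => b θ * φ θ) arc :=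
      hbi.mul_bdd (c := C) hφc.aestronglyMeasurable (ae_of_all _ hC)
    have e3 : ∫ θ, φ θ • (a θ - b θ) = ∫ θ, φ θ • (a θ - b θ) ∂arc := by
      refine (setIntegral_eq_integral_of_forall_compl_eq_zero ?_).symm
      intro x hx
      rw [image_eq_zero_of_notMem_tsupport (fun h => hx (hs h)), zero_smul]
    rw [e3]
    have e4 : ∀ θ, φ θ • (a θ - b θ) = a θ * φ θ - b θ * φ θ := by
      intro θ
      rw [smul_eq_mul]
      ring
    simp_rw [e4]
    rw [integral_sub hia hib]
    linarith)
  rw [Filter.EventuallyEq, ae_restrict_iff' measurableSet_Ioo]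
  filter_upwards [key] with x hx hm
  exact sub_eq_zero.mp (hx hm)

/-- The norm of `L²(0, π)`. -/
def normL2 (f : ℝ → ℝ) : ℝ := √(∫ θ in (0 : ℝ)..Real.pi, f θ ^ 2)

/-- The norm of `H¹(0, π)`. -/
def normH1 (f : ℝ → ℝ) : ℝ :=
  √((∫ θ in (0 : ℝ)..Real.pi, f θ ^ 2) + ∫ θ in (0 : ℝ)..Real.pi, weakDeriv f θ ^ 2)

/-! ### The equilibrium profile -/

/-- Classical derivative on the closed interval `[0, π]`, one-sided at the end points. -/
def dθ (f : ℝ → ℝ) : ℝ → ℝ := derivWithin f (Icc 0 Real.pi)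

/-- `√(ρ² + ρ'²)`, the arc length density of the polar curve `r = ρ(θ)`. -/
def speed (ρ : ℝ → ℝ) (θ : ℝ) : ℝ := √(ρ θ ^ 2 + dθ ρ θ ^ 2)

/-- `ρ₀` is an equilibrium profile of a sessile drop on the horizontal plane, in polar coordinates
whose pole lies on the wetted part of the plane: a positive function on `[0, π]` that solves the
Euler-Lagrange system of
`E(ρ) = (g/3) ∫ ρ³ sin θ + σ ∫ √(ρ² + ρ'²) - γ (ρ(0) + ρ(π))` under the constraint `∫ ρ² = V`.
Here `γ` is the jump `[[γ]]` and `P₀` is the pressure level (the Lagrange multiplier). -/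
structure IsEquilibrium (g σ γ V P₀ : ℝ) (ρ₀ : ℝ → ℝ) : Prop where
  contDiffOn : ContDiffOn ℝ 2 ρ₀ (Icc 0 Real.pi)
  pos : ∀ θ ∈ Icc (0 : ℝ) Real.pi, 0 < ρ₀ θ
  eulerLagrange : ∀ θ ∈ Icc (0 : ℝ) Real.pi,
    g * ρ₀ θ ^ 2 * Real.sin θ + σ * (ρ₀ θ / speed ρ₀ θ)
      - σ * dθ (fun τ => dθ ρ₀ τ / speed ρ₀ τ) θ = P₀ * ρ₀ θ
  contact_right : σ * (dθ ρ₀ 0 / speed ρ₀ 0) = -γ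
  contact_left : σ * (dθ ρ₀ Real.pi / speed ρ₀ Real.pi) = γ
  volume_eq : ∫ θ in (0 : ℝ)..Real.pi, ρ₀ θ ^ 2 = V

/-- The linearized horizontal shift `ξ_s = cos θ + (ρ₀'/ρ₀) sin θ`. -/
def shift (ρ₀ : ℝ → ℝ) (θ : ℝ) : ℝ :=
  Real.cos θ + dθ ρ₀ θ / ρ₀ θ * Real.sin θ

/-- The bilinear form `(u, v)_{1,Σ}`: the second variation at `ρ₀` of the energy `E` under the
volume constraint, polarized. -/
def innerSigma (g σ : ℝ) (ρ₀ u v : ℝ → ℝ) : ℝ :=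
  g * (∫ θ in (0 : ℝ)..Real.pi, ρ₀ θ * u θ * v θ * Real.sin θ)
  + σ * (∫ θ in (0 : ℝ)..Real.pi,
      ρ₀ θ ^ 2 * weakDeriv u θ * weakDeriv v θ / speed ρ₀ θ ^ 3)
  - σ * (∫ θ in (0 : ℝ)..Real.pi, ρ₀ θ * dθ ρ₀ θ * weakDeriv u θ * v θ / speed ρ₀ θ ^ 3)
  - σ * (∫ θ in (0 : ℝ)..Real.pi, ρ₀ θ * dθ ρ₀ θ * u θ * weakDeriv v θ / speed ρ₀ θ ^ 3)
  + σ * (∫ θ in (0 : ℝ)..Real.pi,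
      (dθ (dθ ρ₀) θ * ρ₀ θ - dθ ρ₀ θ ^ 2 - ρ₀ θ ^ 2) / speed ρ₀ θ ^ 3 * u θ * v θ)

/-! ### Perturbations of the equilibrium -/

/-- The time derivative `∂ₜⁱξ(t, ·)`, taken in `L²(0, π)`, as a function on the arc. -/
def timeDeriv (i : ℕ) (ξ : ℝ → L2Arc) (t : ℝ) : ℝ → ℝ := ⇑(iteratedDeriv i ξ t)

/-- `ξ(t, ·)`, `0 < t < T`, is a perturbation of `ρ₀` in the moving polar coordinates: it is twice
differentiable in time with values in `L²(0, π)`, the functions `∂ₜⁱξ(t, ·)`, `i = 0, 1, 2`, lie in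
`H¹(0, π)`, the perturbed profile `ρ₀ + ξ` has the volume `V` of the equilibrium, and `ξ` is
orthogonal to the shift `ξ_s`, which is the condition that fixes the moving pole. -/
structure IsPerturbation (ρ₀ : ℝ → ℝ) (V T : ℝ) (ξ : ℝ → L2Arc) : Prop where
  differentiableAt : ∀ t ∈ Ioo 0 T, DifferentiableAt ℝ ξ t
  differentiableAt_deriv : ∀ t ∈ Ioo 0 T, DifferentiableAt ℝ (deriv ξ) t
  memH1 : ∀ t ∈ Ioo 0 T, ∀ i : Fin 3, MemH1 (timeDeriv i ξ t)
  volume_eq : ∀ t ∈ Ioo 0 T, ∫ θ in (0 : ℝ)..Real.pi, (ρ₀ θ + ξ t θ) ^ 2 = V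
  orthogonal : ∀ t ∈ Ioo 0 T, ∫ θ in (0 : ℝ)..Real.pi, ξ t θ * shift ρ₀ θ = 0

/-- The coefficients `a₀(t), a₁(t), a₂(t)`. -/
def aCoef (ρ₀ : ℝ → ℝ) (ξ : ℝ → L2Arc) (t : ℝ) : Fin 3 → ℝ :=
  ![(-(1 / 2) * ∫ θ in (0 : ℝ)..Real.pi, ξ t θ ^ 2)
      / ∫ θ in (0 : ℝ)..Real.pi, ρ₀ θ ^ 2,
    (-∫ θ in (0 : ℝ)..Real.pi, ξ t θ * timeDeriv 1 ξ t θ)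
      / ∫ θ in (0 : ℝ)..Real.pi, ρ₀ θ ^ 2,
    (-(∫ θ in (0 : ℝ)..Real.pi, timeDeriv 1 ξ t θ ^ 2)
        - ∫ θ in (0 : ℝ)..Real.pi, timeDeriv 2 ξ t θ * ξ t θ)
      / ∫ θ in (0 : ℝ)..Real.pi, ρ₀ θ ^ 2]

/-- The corrected perturbation `∂ₜⁱξ(t, ·) - aᵢ(t) ρ₀`. -/
def corrected (ρ₀ : ℝ → ℝ) (ξ : ℝ → L2Arc) (i : Fin 3) (t : ℝ) : ℝ → ℝ :=
  fun θ => timeDeriv i ξ t θ - aCoef ρ₀ ξ t i * ρ₀ θ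

end

end SessileDrop

open SessileDrop

/-! The second variation is a Sturm-Liouville form Q with natural boundary conditions. Since the
energy is invariant under horizontal translation, v = `shift ρ₀` is a null solution. It changes sign
exactly once, at the highest point m of the drop, so Q is nonnegative on functions that vanish at m,
a space of codimension one. The constraint ∫ w ρ₀ = 0 removes the remaining direction, provided that
L u = lam ρ₀ has a solution u, with natural boundary conditions, such that lam ∫ u ρ₀ < 0 and u(m) ≠
0.

For w orthogonal to ρ₀ put r = w - k u with k = w(m)/u(m). The mixed term vanishes and Q(w) = Q(r) -
k² lam ∫ u ρ₀. As r(m) = 0, Jacobi's identity `integral_quadDensity_eq` turns Q(r) on each side of m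
into the integral of A v² ((r/v)')², which bounds the distance of r from multiples of v
(`exists_sq_sub_le_of_left`, `exists_sq_sub_le_of_right`). The two multiples may differ;
orthogonality to v and to ρ₀ makes both small (`exists_abs_le_of_orthogonal`). The resulting sup
bound and a Gårding inequality give the H¹ bound in `SessileDrop.exists_coercive`.

The geometry supplies v and u. Let y be the height, H its maximum, X and S the horizontal and
vertical components of the outer normal. The first integral is σ S = P y - g y²/2 + γ. A Gronwall
argument gives P > g H (`top_pressure_pos`). Then X/(1 + S) is strictly decreasing, so v has a
simple zero at m and no other (`exists_shiftX_bound`). Vertical translation solves the equation with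
right-hand side g ρ₀ but has nonzero flux at the ends; a multiple E v, found by reduction of order,
cancels this flux and changes lam to g - P/H < 0 (`exists_solution`).

For perturbations, differentiating volume and orthogonality in time shows that each ∂ₜⁱξ - aᵢ ρ₀ is
orthogonal to ρ₀ and to the shift. The remaining bounds follow from Cauchy-Schwarz for aᵢ. -/

namespace SessileDrop

/-! ### Absolutely continuous functions on an interval -/

/-- `F` is absolutely continuous on the interval between `a` and `b`, with derivative `f` almost
everywhere. -/
structure HasACDeriv (a b : ℝ) (F f : ℝ → ℝ) : Prop where
  ac : AbsolutelyContinuousOnInterval F a b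
  ae_hasDerivAt : ∀ᵐ x, x ∈ uIcc a b → HasDerivAt F (f x) x

namespace HasACDeriv

variable {a b c d : ℝ} {F f G g : ℝ → ℝ}

lemma deriv_eq (h : HasACDeriv a b F f) : ∀ᵐ x, x ∈ uIoc a b → deriv F x = f x := by
  filter_upwards [h.ae_hasDerivAt] with x hx hm
  exact (hx (uIoc_subset_uIcc hm)).deriv

lemma intervalIntegrable (h : HasACDeriv a b F f) : IntervalIntegrable f volume a b := by
  refine h.ac.intervalIntegrable_deriv.congr_ae ?_
  rw [EventuallyEq, ae_restrict_iff' measurableSet_uIoc]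
  exact h.deriv_eq

lemma integral_eq_sub (h : HasACDeriv a b F f) : ∫ x in a..b, f x = F b - F a := by
  rw [← h.ac.integral_deriv_eq_sub]
  refine intervalIntegral.integral_congr_ae ?_
  filter_upwards [h.deriv_eq] with x hx hm
  exact (hx hm).symm

lemma continuousOn (h : HasACDeriv a b F f) : ContinuousOn F (uIcc a b) := h.ac.continuousOn

lemma mono (h : HasACDeriv a b F f) (hs : uIcc c d ⊆ uIcc a b) : HasACDeriv c d F f where
  ac := h.ac.mono hs
  ae_hasDerivAt := by
    filter_upwards [h.ae_hasDerivAt] with x hx hm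
    exact hx (hs hm)

lemma add (h : HasACDeriv a b F f) (k : HasACDeriv a b G g) :
    HasACDeriv a b (fun x => F x + G x) (fun x => f x + g x) where
  ac := h.ac.add k.ac
  ae_hasDerivAt := by
    filter_upwards [h.ae_hasDerivAt, k.ae_hasDerivAt] with x hx kx hm
    exact (hx hm).add (kx hm)

lemma sub (h : HasACDeriv a b F f) (k : HasACDeriv a b G g) :
    HasACDeriv a b (fun x => F x - G x) (fun x => f x - g x) where
  ac := h.ac.sub k.ac
  ae_hasDerivAt := by
    filter_upwards [h.ae_hasDerivAt, k.ae_hasDerivAt] with x hx kx hm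
    exact (hx hm).sub (kx hm)

lemma const_mul (h : HasACDeriv a b F f) (k : ℝ) :
    HasACDeriv a b (fun x => k * F x) (fun x => k * f x) where
  ac := h.ac.const_mul k
  ae_hasDerivAt := by
    filter_upwards [h.ae_hasDerivAt] with x hx hm
    exact (hx hm).const_mul k

lemma mul (h : HasACDeriv a b F f) (k : HasACDeriv a b G g) :
    HasACDeriv a b (fun x => F x * G x) (fun x => f x * G x + F x * g x) where
  ac := h.ac.fun_mul k.ac
  ae_hasDerivAt := by
    filter_upwards [h.ae_hasDerivAt, k.ae_hasDerivAt] with x hx kx hm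
    exact (hx hm).mul (kx hm)

lemma congr_deriv (h : HasACDeriv a b F f) (e : ∀ᵐ x, x ∈ uIcc a b → f x = g x) :
    HasACDeriv a b F g where
  ac := h.ac
  ae_hasDerivAt := by
    filter_upwards [h.ae_hasDerivAt, e] with x hx ex hm
    exact ex hm ▸ hx hm

/-- The primitive of an integrable function. -/
lemma of_intervalIntegrable (hf : IntervalIntegrable f volume a b) (k : ℝ) :
    HasACDeriv a b (fun x => k + ∫ t in a..x, f t) f where
  ac := by
    have h1 : AbsolutelyContinuousOnInterval (fun _ : ℝ => k) a b :=
      (LipschitzWith.const k).lipschitzOnWith.absolutelyContinuousOnInterval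
    exact h1.add (hf.absolutelyContinuousOnInterval_intervalIntegral left_mem_uIcc)
  ae_hasDerivAt := by
    filter_upwards [hf.ae_hasDerivAt_integral] with x hx hm
    exact (hx hm a left_mem_uIcc).const_add k

/-- A function that is continuously differentiable on a compact interval. -/
lemma of_hasDerivWithinAt (hab : a ≤ b)
    (h : ∀ x ∈ Icc a b, HasDerivWithinAt F (f x) (Icc a b) x) (hf : ContinuousOn f (Icc a b)) :
    HasACDeriv a b F f where
  ac := by
    obtain ⟨C, hC⟩ := isCompact_Icc.exists_bound_of_continuousOn hf
    have hC' : ∀ x ∈ Icc a b, ‖f x‖₊ ≤ C.toNNReal := fun x hx => by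
      rw [← NNReal.coe_le_coe, coe_nnnorm]
      exact (hC x hx).trans (Real.le_coe_toNNReal C)
    have := (convex_Icc a b).lipschitzOnWith_of_nnnorm_hasDerivWithin_le h hC'
    rw [← uIcc_of_le hab] at this
    exact this.absolutelyContinuousOnInterval
  ae_hasDerivAt := by
    rw [uIcc_of_le hab]
    have h1 : ∀ᵐ x : ℝ, x ≠ a := by simp [ae_iff, measure_singleton]
    have h2 : ∀ᵐ x : ℝ, x ≠ b := by simp [ae_iff, measure_singleton]
    filter_upwards [h1, h2] with x xa xb hx
    exact (h x hx).hasDerivAt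
      (Icc_mem_nhds (lt_of_le_of_ne hx.1 (Ne.symm xa)) (lt_of_le_of_ne hx.2 xb))

/-- Reflection at the origin. -/
lemma exists_reflect (hab : a ≤ b) (h : HasACDeriv a b F f) :
    ∃ G, HasACDeriv (-b) (-a) G (fun x => -f (-x)) ∧ ∀ x ∈ Icc (-b) (-a), G x = F (-x) := by
  have hi : IntervalIntegrable (fun x => -f (-x)) volume (-b) (-a) := by
    have := ((IntervalIntegrable.iff_comp_neg (by simp)).mp h.intervalIntegrable).symm.neg
    exact this
  -- The reflection is rebuilt as a primitive starting from F b at -b; it need agree with F (-x)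
  -- only on the interval.
  refine ⟨_, of_intervalIntegrable hi (F b), ?_⟩
  intro x hx
  have hx' : -x ∈ uIcc a b := by
    rw [uIcc_of_le hab]
    constructor <;> linarith [hx.1, hx.2]
  have e := (h.mono (uIcc_subset_uIcc hx' right_mem_uIcc)).integral_eq_sub
  have e2 : ∫ t in (-b)..x, -f (-t) = -∫ t in (-x)..b, f t := by
    rw [intervalIntegral.integral_neg, intervalIntegral.integral_comp_neg]
    simp
  rw [e2, e]
  ring

end HasACDeriv

/-! ### Quadratic forms and Jacobi's identity -/

/-- The Cauchy-Schwarz inequality for interval integrals. -/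
lemma sq_integral_mul_le {a b : ℝ} (hab : a ≤ b) {f g : ℝ → ℝ}
    (hf : IntervalIntegrable (fun x => f x ^ 2) volume a b)
    (hg : IntervalIntegrable (fun x => g x ^ 2) volume a b)
    (hfg : IntervalIntegrable (fun x => f x * g x) volume a b) :
    (∫ x in a..b, f x * g x) ^ 2 ≤ (∫ x in a..b, f x ^ 2) * ∫ x in a..b, g x ^ 2 := by
  have key : ∀ t : ℝ, 0 ≤ (∫ x in a..b, g x ^ 2) * (t * t) + (2 * ∫ x in a..b, f x * g x) * t
      + ∫ x in a..b, f x ^ 2 := by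
    intro t
    have h0 : 0 ≤ ∫ x in a..b, (f x + t * g x) ^ 2 :=
      intervalIntegral.integral_nonneg hab fun x _ => sq_nonneg _
    have e : ∫ x in a..b, (f x + t * g x) ^ 2
        = ∫ x in a..b, (f x ^ 2 + (2 * t) * (f x * g x)) + t ^ 2 * g x ^ 2 := by
      congr 1; ext x; ring
    rw [e, intervalIntegral.integral_add (hf.add (hfg.const_mul _)) (hg.const_mul _),
      intervalIntegral.integral_add hf (hfg.const_mul _), intervalIntegral.integral_const_mul,
      intervalIntegral.integral_const_mul] at h0
    linarith
  have := discrim_le_zero key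
  rw [discrim] at this
  linarith

/-- The density of the quadratic form with coefficients `A`, `B`, `D`. -/
def quadDensity (A B D F f : ℝ → ℝ) (x : ℝ) : ℝ :=
  A x * f x ^ 2 - 2 * B x * F x * f x + D x * F x ^ 2

lemma intervalIntegrable_quadDensity {a b : ℝ} {A B D F f : ℝ → ℝ}
    (hA : ContinuousOn A (uIcc a b)) (hB : ContinuousOn B (uIcc a b))
    (hD : ContinuousOn D (uIcc a b)) (hF : HasACDeriv a b F f)
    (hf : IntervalIntegrable (fun x => f x ^ 2) volume a b) :
    IntervalIntegrable (quadDensity A B D F f) volume a b := by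
  refine ((hf.continuousOn_mul hA).sub (hF.intervalIntegrable.continuousOn_mul
    (((continuousOn_const (c := (2 : ℝ))).mul hB).mul hF.continuousOn))).add
    (ContinuousOn.intervalIntegrable (hD.mul (hF.continuousOn.pow 2)))

lemma continuousOn_of_hasDerivWithinAt {F f : ℝ → ℝ} {s : Set ℝ}
    (h : ∀ x ∈ s, HasDerivWithinAt F (f x) s x) : ContinuousOn F s :=
  fun x hx => (h x hx).continuousWithinAt

/-- Completing the square with a positive null solution `v` (Jacobi's identity). -/
lemma integral_quadDensity_eq {a b : ℝ} (hab : a ≤ b) {A B D v v' J r r' : ℝ → ℝ}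
    (hA : ContinuousOn A (Icc a b)) (hB : ContinuousOn B (Icc a b)) (hD : ContinuousOn D (Icc a b))
    (hv : ∀ x ∈ Icc a b, HasDerivWithinAt v (v' x) (Icc a b) x) (hv' : ContinuousOn v' (Icc a b))
    (hJ : ∀ x ∈ Icc a b, J x = A x * v' x - B x * v x)
    (hJ' : ∀ x ∈ Icc a b, HasDerivWithinAt J (D x * v x - B x * v' x) (Icc a b) x)
    (hpos : ∀ x ∈ Icc a b, 0 < v x)
    (hr : HasACDeriv a b r r') (hr2 : IntervalIntegrable (fun x => r' x ^ 2) volume a b) :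
    HasACDeriv a b (fun x => r x / v x) (fun x => (r' x * v x - r x * v' x) / v x ^ 2) ∧
    IntervalIntegrable (fun x => A x * (v x * ((r' x * v x - r x * v' x) / v x ^ 2)) ^ 2)
      volume a b ∧
    ∫ x in a..b, quadDensity A B D r r' x
      = (∫ x in a..b, A x * (v x * ((r' x * v x - r x * v' x) / v x ^ 2)) ^ 2)
        + (r b ^ 2 * (J b / v b) - r a ^ 2 * (J a / v a)) := by
  have hu : uIcc a b = Icc a b := uIcc_of_le hab
  have hvc : ContinuousOn v (Icc a b) := continuousOn_of_hasDerivWithinAt hv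
  have hJc : ContinuousOn J (Icc a b) := continuousOn_of_hasDerivWithinAt hJ'
  have hne : ∀ x ∈ Icc a b, v x ≠ 0 := fun x hx => (hpos x hx).ne'
  have hvi : HasACDeriv a b (fun x => (v x)⁻¹) (fun x => -v' x / v x ^ 2) :=
    HasACDeriv.of_hasDerivWithinAt hab (fun x hx => (hv x hx).fun_inv (hne x hx))
      (hv'.neg.div (hvc.pow 2) fun x hx => pow_ne_zero 2 (hne x hx))
  have hq : HasACDeriv a b (fun x => r x / v x) (fun x => (r' x * v x - r x * v' x) / v x ^ 2) := by
    have := hr.mul hvi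
    simp only [← div_eq_mul_inv] at this
    refine this.congr_deriv (ae_of_all _ fun x hx => ?_)
    have := hne x (hu ▸ hx)
    field_simp
    ring
  have hJv : HasACDeriv a b (fun x => J x / v x)
      (fun x => ((D x * v x - B x * v' x) * v x - J x * v' x) / v x ^ 2) := by
    refine HasACDeriv.of_hasDerivWithinAt hab
      (fun x hx => (hJ' x hx).fun_div (hv x hx) (hne x hx)) ?_
    exact ((((hD.mul hvc).sub (hB.mul hv')).mul hvc).sub (hJc.mul hv')).div (hvc.pow 2)
      fun x hx => pow_ne_zero 2 (hne x hx)
  -- By the equation for v, the density minus the total derivative of r² J/v is the perfect square A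
  -- v² ((r/v)')².
  have hF := (hr.mul hr).mul hJv
  have hint := intervalIntegrable_quadDensity (hu ▸ hA) (hu ▸ hB) (hu ▸ hD) hr hr2
  have hpt : ∀ x ∈ uIcc a b, quadDensity A B D r r' x
      - ((r' x * r x + r x * r' x) * (J x / v x)
        + r x * r x * (((D x * v x - B x * v' x) * v x - J x * v' x) / v x ^ 2))
      = A x * (v x * ((r' x * v x - r x * v' x) / v x ^ 2)) ^ 2 := by
    intro x hx
    rw [hu] at hx
    have := hne x hx
    rw [quadDensity, hJ x hx]
    field_simp
    ring
  refine ⟨hq, (hint.sub hF.intervalIntegrable).congr fun x hx => hpt x (uIoc_subset_uIcc hx), ?_⟩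
  have e1 := hF.integral_eq_sub
  have e2 := intervalIntegral.integral_sub hint hF.intervalIntegrable
  rw [intervalIntegral.integral_congr hpt, e1] at e2
  linarith

/-- On an interval at whose right end a positive null solution `v` vanishes to first order, the
quadratic form controls functions that vanish there, up to multiples of `v`. -/
lemma exists_sq_sub_le_of_left {a m : ℝ} (ham : a < m) {A B D v v' J : ℝ → ℝ} {α c C : ℝ}
    (hA : ContinuousOn A (Icc a m)) (hB : ContinuousOn B (Icc a m)) (hD : ContinuousOn D (Icc a m))
    (hα : 0 < α) (hAα : ∀ x ∈ Icc a m, α ≤ A x)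
    (hv : ∀ x ∈ Icc a m, HasDerivWithinAt v (v' x) (Icc a m) x) (hv' : ContinuousOn v' (Icc a m))
    (hJ : ∀ x ∈ Icc a m, J x = A x * v' x - B x * v x)
    (hJ' : ∀ x ∈ Icc a m, HasDerivWithinAt J (D x * v x - B x * v' x) (Icc a m) x)
    (hJa : J a = 0) (hc : 0 < c) (hlow : ∀ x ∈ Icc a m, c * (m - x) ≤ v x)
    (hupp : ∀ x ∈ Icc a m, v x ≤ C * (m - x)) :
    ∃ K > 0, ∀ r r' : ℝ → ℝ, HasACDeriv a m r r' →
      IntervalIntegrable (fun x => r' x ^ 2) volume a m → r m = 0 →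
      ∃ k : ℝ, ∀ x ∈ Icc a m,
        (r x - k * v x) ^ 2 ≤ K * ∫ x in a..m, quadDensity A B D r r' x := by
  have hC : 0 < C := by
    have h1 := hlow a (left_mem_Icc.2 ham.le)
    have h2 := hupp a (left_mem_Icc.2 ham.le)
    have h3 : 0 < m - a := sub_pos.2 ham
    nlinarith
  -- The constant comes from writing r(t)/v(t) - r(a)/v(a) as the integral of (r/v)' and applying
  -- Cauchy-Schwarz. The factor v(t)² moves inside the integral because v is comparable to m - x:
  -- for x ≤ t one has c v(t) ≤ C v(x). The lower bound α for A accounts for the rest.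
  have hK : 0 < (m - a) * C ^ 2 / (α * c ^ 2) := by
    have h3 : 0 < m - a := sub_pos.2 ham
    positivity
  refine ⟨_, hK, ?_⟩
  set K := (m - a) * C ^ 2 / (α * c ^ 2) with hKdef
  intro r r' hr hr2 hrm
  have hu : uIcc a m = Icc a m := uIcc_of_le ham.le
  have hint := intervalIntegrable_quadDensity (hu ▸ hA) (hu ▸ hB) (hu ▸ hD) hr hr2
  have hJc : ContinuousOn J (Icc a m) := continuousOn_of_hasDerivWithinAt hJ'
  have hvm : v m = 0 := by
    have h1 := hlow m (right_mem_Icc.2 ham.le)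
    have h2 := hupp m (right_mem_Icc.2 ham.le)
    simp only [sub_self, mul_zero] at h1 h2
    exact le_antisymm h2 h1
  have hvpos : ∀ x ∈ Icc a m, x < m → 0 < v x := fun x hx hxm =>
    lt_of_lt_of_le (mul_pos hc (sub_pos.2 hxm)) (hlow x hx)
  set Q : ℝ → ℝ := fun τ => ∫ x in a..τ, quadDensity A B D r r' x with hQ
  -- the bound on `[a, τ]` with the boundary term at `τ`
  have step : ∀ t τ, a ≤ t → t ≤ τ → τ < m →
      (r t - r a / v a * v t) ^ 2 ≤ K * (Q τ - r τ ^ 2 * (J τ / v τ)) := by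
    intro t τ hat htτ hτm
    have haτ : a ≤ τ := hat.trans htτ
    have hsub : Icc a τ ⊆ Icc a m := Icc_subset_Icc_right hτm.le
    have huτ : uIcc a τ = Icc a τ := uIcc_of_le haτ
    obtain ⟨hq, hqi, e⟩ := integral_quadDensity_eq haτ (hA.mono hsub) (hB.mono hsub)
      (hD.mono hsub) (fun x hx => (hv x (hsub hx)).mono hsub) (hv'.mono hsub)
      (fun x hx => hJ x (hsub hx)) (fun x hx => (hJ' x (hsub hx)).mono hsub)
      (fun x hx => hvpos x (hsub hx) (hx.2.trans_lt hτm))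
      (hr.mono (by rw [hu, huτ]; exact hsub))
      (hr2.mono_set (by rw [hu, huτ]; exact hsub))
    set q' : ℝ → ℝ := fun x => (r' x * v x - r x * v' x) / v x ^ 2 with hq'
    -- The natural boundary condition at a leaves only the boundary term at τ.
    rw [hJa, zero_div, mul_zero, sub_zero] at e
    have hsubt : Icc a t ⊆ Icc a τ := Icc_subset_Icc_right htτ
    have hut : uIcc a t = Icc a t := uIcc_of_le hat
    have hqt := hq.mono (c := a) (d := t) (by rw [hut, huτ]; exact hsubt)
    have hqit : IntervalIntegrable (fun x => A x * (v x * q' x) ^ 2) volume a t :=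
      hqi.mono_set (by rw [hut, huτ]; exact hsubt)
    have hvc : ContinuousOn v (Icc a m) := continuousOn_of_hasDerivWithinAt hv
    have hq2 : IntervalIntegrable (fun x => q' x ^ 2) volume a t := by
      have hcont : ContinuousOn (fun x => (A x * v x ^ 2)⁻¹) (uIcc a t) := by
        rw [hut]
        refine ContinuousOn.inv₀ ((hA.mono (hsubt.trans hsub)).mul
          ((hvc.mono (hsubt.trans hsub)).pow 2)) fun x hx => ?_
        have h1 := hvpos x (hsub (hsubt hx)) ((hsubt hx).2.trans_lt hτm)
        have h2 := hα.trans_le (hAα x (hsub (hsubt hx)))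
        positivity
      refine (hqit.continuousOn_mul hcont).congr fun x hx => ?_
      have hx' : x ∈ Icc a t := hut ▸ uIoc_subset_uIcc hx
      have h1 := hvpos x (hsub (hsubt hx')) ((hsubt hx').2.trans_lt hτm)
      have h2 := hα.trans_le (hAα x (hsub (hsubt hx')))
      field_simp
    have hva := hvpos a (left_mem_Icc.2 ham.le) ham
    have htm : t < m := htτ.trans_lt hτm
    have hvt := hvpos t ⟨hat, htm.le⟩ htm
    have hcs := sq_integral_mul_le hat (f := fun _ => (1 : ℝ)) (g := q') (by simp) hq2
      (by simpa using hqt.intervalIntegrable)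
    simp only [one_mul, one_pow, intervalIntegral.integral_const, smul_eq_mul, mul_one] at hcs
    rw [hqt.integral_eq_sub] at hcs
    have hmono : ∫ x in a..t, A x * (v x * q' x) ^ 2 ≤ ∫ x in a..τ, A x * (v x * q' x) ^ 2 := by
      refine intervalIntegral.integral_mono_interval le_rfl hat htτ ?_ hqi
      filter_upwards [self_mem_ae_restrict measurableSet_Ioc] with x hx
      exact mul_nonneg (hα.le.trans (hAα x (hsub ⟨hx.1.le, hx.2⟩))) (sq_nonneg _)
    have hcomp : v t ^ 2 * ∫ x in a..t, q' x ^ 2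
        ≤ C ^ 2 / (α * c ^ 2) * ∫ x in a..t, A x * (v x * q' x) ^ 2 := by
      rw [← intervalIntegral.integral_const_mul, ← intervalIntegral.integral_const_mul]
      refine intervalIntegral.integral_mono_on hat (hq2.const_mul _) (hqit.const_mul _) ?_
      intro x hx
      have hxm := hsub (hsubt hx)
      have h1 : c * v t ≤ C * v x := by
        have h2 := hupp t ⟨hat, htm.le⟩
        have h3 := hlow x hxm
        have h4 : C * (m - t) ≤ C * (m - x) := by
          have := hx.2
          gcongr
        calc c * v t ≤ c * (C * (m - x)) := by gcongr; linarith
          _ = C * (c * (m - x)) := by ring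
          _ ≤ C * v x := by gcongr
      have h5 : (c * v t) ^ 2 ≤ (C * v x) ^ 2 := by gcongr
      have h6 := hAα x hxm
      have h7 : v t ^ 2 * q' x ^ 2 = (c * v t) ^ 2 * (α * q' x ^ 2) / (α * c ^ 2) := by
        field_simp
      have h8 : C ^ 2 / (α * c ^ 2) * (A x * (v x * q' x) ^ 2)
          = (C * v x) ^ 2 * (A x * q' x ^ 2) / (α * c ^ 2) := by
        field_simp
      rw [h7, h8]
      gcongr
    have hlhs : (r t - r a / v a * v t) ^ 2 = v t ^ 2 * (r t / v t - r a / v a) ^ 2 := by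
      field_simp
    have hCS : (0:ℝ) < C ^ 2 / (α * c ^ 2) := by positivity
    have hQτ : Q τ - r τ ^ 2 * (J τ / v τ) = ∫ x in a..τ, A x * (v x * q' x) ^ 2 := by
      simp only [hQ, e]
      ring
    rw [hlhs, hQτ]
    have hI : 0 ≤ ∫ x in a..t, q' x ^ 2 :=
      intervalIntegral.integral_nonneg hat fun x _ => sq_nonneg _
    calc v t ^ 2 * (r t / v t - r a / v a) ^ 2
        ≤ v t ^ 2 * ((t - a) * ∫ x in a..t, q' x ^ 2) := by gcongr
      _ = (t - a) * (v t ^ 2 * ∫ x in a..t, q' x ^ 2) := by ring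
      _ ≤ (m - a) * (v t ^ 2 * ∫ x in a..t, q' x ^ 2) := by gcongr
      _ ≤ (m - a) * (C ^ 2 / (α * c ^ 2) * ∫ x in a..t, A x * (v x * q' x) ^ 2) := by
          have := ham.le
          gcongr
      _ = K * ∫ x in a..t, A x * (v x * q' x) ^ 2 := by rw [hKdef]; ring
      _ ≤ _ := by gcongr
  -- the boundary term disappears at `m`
  have hlimQ : Tendsto Q (𝓝[<] m) (𝓝 (Q m)) := by
    have h1 : ContinuousOn Q (uIcc a m) := intervalIntegral.continuousOn_primitive_interval'
      hint left_mem_uIcc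
    rw [hu] at h1
    exact (h1 m (right_mem_Icc.2 ham.le)).mono_of_mem_nhdsWithin
      (Icc_mem_nhdsLT ham)
  have hlimT : Tendsto (fun τ => ∫ x in τ..m, r' x ^ 2) (𝓝[<] m) (𝓝 0) := by
    have h1 : ContinuousOn (fun τ => ∫ x in m..τ, r' x ^ 2) (uIcc a m) :=
      intervalIntegral.continuousOn_primitive_interval' hr2 right_mem_uIcc
    rw [hu] at h1
    have h2 : Tendsto (fun τ => -∫ x in m..τ, r' x ^ 2) (𝓝[<] m)
        (𝓝 (-∫ x in m..m, r' x ^ 2)) :=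
      ((h1 m (right_mem_Icc.2 ham.le)).mono_of_mem_nhdsWithin (Icc_mem_nhdsLT ham)).neg
    simp only [intervalIntegral.integral_same, neg_zero] at h2
    refine h2.congr fun τ => ?_
    rw [intervalIntegral.integral_symm, neg_neg]
  -- As r(m) = 0, r(τ)² is at most (m - τ) times the integral of r'² over [τ, m], while v(τ) ≥ c (m
  -- - τ). The quotient is thus bounded by a constant times a tail integral, which tends to zero.
  have hlimR : Tendsto (fun τ => r τ ^ 2 * (J τ / v τ)) (𝓝[<] m) (𝓝 0) := by
    obtain ⟨CJ, hCJ⟩ := isCompact_Icc.exists_bound_of_continuousOn hJc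
    have hz := hlimT.const_mul (CJ / c)
    rw [mul_zero] at hz
    refine squeeze_zero_norm' ?_ hz
    filter_upwards [Ico_mem_nhdsLT ham] with τ hτ
    have hτI : τ ∈ Icc a m := ⟨hτ.1, hτ.2.le⟩
    have hvτ := hvpos τ hτI hτ.2
    have hpos : 0 < m - τ := sub_pos.2 hτ.2
    have hs : uIcc τ m ⊆ uIcc a m := by
      rw [hu, uIcc_of_le hτ.2.le]
      exact Icc_subset_Icc_left hτ.1
    have hrτ := hr.mono hs
    have hcs := sq_integral_mul_le hτ.2.le (f := fun _ => (1 : ℝ)) (g := r') (by simp)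
      (hr2.mono_set hs) (by simpa using hrτ.intervalIntegrable)
    simp only [one_mul, one_pow, intervalIntegral.integral_const, smul_eq_mul, mul_one] at hcs
    rw [hrτ.integral_eq_sub, hrm, zero_sub, neg_sq] at hcs
    have hT : 0 ≤ ∫ x in τ..m, r' x ^ 2 :=
      intervalIntegral.integral_nonneg hτ.2.le fun x _ => sq_nonneg _
    rw [Real.norm_eq_abs, abs_mul, abs_div, abs_of_nonneg (sq_nonneg (r τ)), abs_of_pos hvτ]
    have hJb := hCJ τ hτI
    rw [Real.norm_eq_abs] at hJb
    have hCJ0 : 0 ≤ CJ := (abs_nonneg _).trans hJb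
    calc r τ ^ 2 * (|J τ| / v τ)
        ≤ ((m - τ) * ∫ x in τ..m, r' x ^ 2) * (CJ / (c * (m - τ))) := by
          have := hlow τ hτI
          gcongr
      _ = CJ / c * ∫ x in τ..m, r' x ^ 2 := by field_simp
  refine ⟨r a / v a, ?_⟩
  have main : ∀ t, a ≤ t → t < m → (r t - r a / v a * v t) ^ 2 ≤ K * Q m := by
    intro t hat htm
    have hl : Tendsto (fun τ => K * (Q τ - r τ ^ 2 * (J τ / v τ))) (𝓝[<] m)
        (𝓝 (K * (Q m - 0))) := (hlimQ.sub hlimR).const_mul K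
    rw [sub_zero] at hl
    refine ge_of_tendsto hl ?_
    filter_upwards [Ico_mem_nhdsLT htm] with τ hτ
    exact step t τ hat hτ.1 hτ.2
  intro x hx
  rcases hx.2.lt_or_eq with h | h
  · exact main x hx.1 h
  · rw [h, hrm, hvm]
    have := (sq_nonneg _).trans (main a le_rfl ham)
    simpa using this

lemma hasDerivWithinAt_comp_neg {F : ℝ → ℝ} {f' a b x : ℝ}
    (h : HasDerivWithinAt F f' (Icc a b) (-x)) :
    HasDerivWithinAt (fun t => F (-t)) (-f') (Icc (-b) (-a)) x := by
  have := h.comp x (h₂ := F) ((hasDerivAt_neg x).hasDerivWithinAt (s := Icc (-b) (-a)))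
    (fun t ht => ⟨by linarith [ht.2], by linarith [ht.1]⟩)
  simpa [Function.comp_def] using this

lemma continuousOn_comp_neg {F : ℝ → ℝ} {a b : ℝ} (h : ContinuousOn F (Icc a b)) :
    ContinuousOn (fun t => F (-t)) (Icc (-b) (-a)) :=
  h.comp continuous_neg.continuousOn fun t ht => ⟨by linarith [ht.2], by linarith [ht.1]⟩

/-- The mirror image of `exists_sq_sub_le_of_left`. -/
lemma exists_sq_sub_le_of_right {m b : ℝ} (hmb : m < b) {A B D v v' J : ℝ → ℝ} {α c C : ℝ}
    (hA : ContinuousOn A (Icc m b)) (hB : ContinuousOn B (Icc m b)) (hD : ContinuousOn D (Icc m b))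
    (hα : 0 < α) (hAα : ∀ x ∈ Icc m b, α ≤ A x)
    (hv : ∀ x ∈ Icc m b, HasDerivWithinAt v (v' x) (Icc m b) x) (hv' : ContinuousOn v' (Icc m b))
    (hJ : ∀ x ∈ Icc m b, J x = A x * v' x - B x * v x)
    (hJ' : ∀ x ∈ Icc m b, HasDerivWithinAt J (D x * v x - B x * v' x) (Icc m b) x)
    (hJb : J b = 0) (hc : 0 < c) (hlow : ∀ x ∈ Icc m b, c * (x - m) ≤ -v x)
    (hupp : ∀ x ∈ Icc m b, -v x ≤ C * (x - m)) :
    ∃ K > 0, ∀ r r' : ℝ → ℝ, HasACDeriv m b r r' →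
      IntervalIntegrable (fun x => r' x ^ 2) volume m b → r m = 0 →
      ∃ k : ℝ, ∀ x ∈ Icc m b,
        (r x - k * v x) ^ 2 ≤ K * ∫ x in m..b, quadDensity A B D r r' x := by
  have mem : ∀ x ∈ Icc (-b) (-m), -x ∈ Icc m b := fun x hx =>
    ⟨by linarith [hx.2], by linarith [hx.1]⟩
  -- Under x ↦ -x the sign of B flips along with that of the derivative. Negating v as well makes it
  -- positive on the reflected interval and leaves the flux J unchanged; the multiple k of v becomes
  -- -k at the end.
  obtain ⟨K, hK, h⟩ := exists_sq_sub_le_of_left (a := -b) (m := -m) (neg_lt_neg hmb)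
    (A := fun x => A (-x)) (B := fun x => -B (-x)) (D := fun x => D (-x))
    (v := fun x => -v (-x)) (v' := fun x => v' (-x)) (J := fun x => J (-x)) (C := C)
    (continuousOn_comp_neg hA) (continuousOn_comp_neg hB).neg (continuousOn_comp_neg hD) hα
    (fun x hx => hAα _ (mem x hx))
    (fun x hx => by simpa using (hasDerivWithinAt_comp_neg (hv _ (mem x hx))).fun_neg)
    (continuousOn_comp_neg hv')
    (fun x hx => by rw [hJ _ (mem x hx)]; ring)
    (fun x hx => by
      convert hasDerivWithinAt_comp_neg (hJ' _ (mem x hx)) using 1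
      ring)
    (by simpa using hJb) hc
    (fun x hx => by have := hlow _ (mem x hx); linarith)
    (fun x hx => by have := hupp _ (mem x hx); linarith)
  refine ⟨K, hK, fun r r' hr hr2 hrm => ?_⟩
  obtain ⟨G, hG, hGr⟩ := hr.exists_reflect hmb.le
  have hg2 : IntervalIntegrable (fun x => (-r' (-x)) ^ 2) volume (-b) (-m) := by
    have := ((IntervalIntegrable.iff_comp_neg (by simp)).mp hr2).symm
    simpa only [neg_sq] using this
  obtain ⟨k, hk⟩ := h G _ hG hg2 (by
    rw [hGr _ (right_mem_Icc.2 (neg_le_neg hmb.le)), neg_neg, hrm])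
  have e : ∫ x in (-b)..(-m), quadDensity (fun x => A (-x)) (fun x => -B (-x)) (fun x => D (-x))
      G (fun x => -r' (-x)) x = ∫ x in m..b, quadDensity A B D r r' x := by
    have e1 := intervalIntegral.integral_comp_neg (a := -b) (b := -m)
      (fun x => quadDensity A B D r r' x)
    rw [neg_neg, neg_neg] at e1
    rw [← e1]
    refine intervalIntegral.integral_congr fun x hx => ?_
    rw [uIcc_of_le (neg_le_neg hmb.le)] at hx
    simp only [quadDensity, hGr x hx]
    ring
  rw [e] at hk
  refine ⟨-k, fun x hx => ?_⟩
  have := hk (-x) ⟨by linarith [hx.2], by linarith [hx.1]⟩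
  rw [hGr _ ⟨by linarith [hx.2], by linarith [hx.1]⟩, neg_neg] at this
  convert this using 2
  ring

/-! ### Coercivity from a null solution with one sign change -/

/-- The bilinear form with coefficients `A`, `B`, `D` on functions with given derivatives. -/
noncomputable def bilin (A B D : ℝ → ℝ) (a b : ℝ) (F f G g : ℝ → ℝ) : ℝ :=
  ∫ x in a..b, (A x * f x * g x - B x * (f x * G x + F x * g x) + D x * F x * G x)

/-- Integration by parts against a solution `u` of the Euler-Lagrange equation with right hand
side `R` and natural boundary conditions. -/
lemma bilin_eq_of_solution {a b : ℝ} (hab : a ≤ b) {A B D u u' J R F f : ℝ → ℝ}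
    (hB : ContinuousOn B (Icc a b)) (hD : ContinuousOn D (Icc a b))
    (hu : ∀ x ∈ Icc a b, HasDerivWithinAt u (u' x) (Icc a b) x) (hu' : ContinuousOn u' (Icc a b))
    (hJ : ∀ x ∈ Icc a b, J x = A x * u' x - B x * u x)
    (hJ' : ∀ x ∈ Icc a b, HasDerivWithinAt J (D x * u x - B x * u' x - R x) (Icc a b) x)
    (hR : ContinuousOn R (Icc a b)) (hJa : J a = 0) (hJb : J b = 0) (hF : HasACDeriv a b F f) :
    bilin A B D a b F f u u' = ∫ x in a..b, F x * R x := by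
  have huab : uIcc a b = Icc a b := uIcc_of_le hab
  have huc := continuousOn_of_hasDerivWithinAt hu
  have hJAC : HasACDeriv a b J (fun x => D x * u x - B x * u' x - R x) :=
    HasACDeriv.of_hasDerivWithinAt hab hJ' (((hD.mul huc).sub (hB.mul hu')).sub hR)
  have hFJ := hF.mul hJAC
  have hFR : IntervalIntegrable (fun x => F x * R x) volume a b :=
    (hF.continuousOn.mul (huab ▸ hR)).intervalIntegrable
  have e : bilin A B D a b F f u u' = ∫ x in a..b,
      ((f x * J x + F x * (D x * u x - B x * u' x - R x)) + F x * R x) := by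
    refine intervalIntegral.integral_congr fun x hx => ?_
    rw [huab] at hx
    simp only [hJ x hx]
    ring
  rw [e, intervalIntegral.integral_add hFJ.intervalIntegrable hFR, hFJ.integral_eq_sub, hJa, hJb]
  ring

/-- Expansion of the quadratic form along a continuously differentiable direction. -/
lemma integral_quadDensity_sub {a b : ℝ} (hab : a ≤ b) {A B D u u' F f : ℝ → ℝ}
    (hA : ContinuousOn A (Icc a b)) (hB : ContinuousOn B (Icc a b)) (hD : ContinuousOn D (Icc a b))
    (hu : ∀ x ∈ Icc a b, HasDerivWithinAt u (u' x) (Icc a b) x) (hu' : ContinuousOn u' (Icc a b))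
    (hF : HasACDeriv a b F f) (hf : IntervalIntegrable (fun x => f x ^ 2) volume a b) (k : ℝ) :
    IntervalIntegrable (fun x => (f x - k * u' x) ^ 2) volume a b ∧
    ∫ x in a..b, quadDensity A B D (fun x => F x - k * u x) (fun x => f x - k * u' x) x
      = (∫ x in a..b, quadDensity A B D F f x) - 2 * k * bilin A B D a b F f u u'
        + k ^ 2 * bilin A B D a b u u' u u' := by
  have huab : uIcc a b = Icc a b := uIcc_of_le hab
  have huc := continuousOn_of_hasDerivWithinAt hu
  rw [← huab] at hA hB hD hu' huc
  have i1 := intervalIntegrable_quadDensity hA hB hD hF hf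
  have hfi := hF.intervalIntegrable
  have hFc := hF.continuousOn
  have i2 : IntervalIntegrable (fun x => A x * f x * u' x - B x * (f x * u x + F x * u' x)
      + D x * F x * u x) volume a b := by
    have j1 : IntervalIntegrable (fun x => f x * (A x * u' x)) volume a b :=
      hfi.mul_continuousOn (hA.mul hu')
    have j2 : IntervalIntegrable (fun x => f x * (B x * u x)) volume a b :=
      hfi.mul_continuousOn (hB.mul huc)
    have j3 : IntervalIntegrable (fun x => B x * (F x * u' x)) volume a b :=
      (hB.mul (hFc.mul hu')).intervalIntegrable
    have j4 : IntervalIntegrable (fun x => D x * F x * u x) volume a b :=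
      ((hD.mul hFc).mul huc).intervalIntegrable
    refine (((j1.sub j2).sub j3).add j4).congr fun x _ => ?_
    ring
  have i3 : IntervalIntegrable (fun x => A x * u' x * u' x - B x * (u' x * u x + u x * u' x)
      + D x * u x * u x) volume a b :=
    ContinuousOn.intervalIntegrable (((hA.mul hu').mul hu').sub
      (hB.mul ((hu'.mul huc).add (huc.mul hu'))) |>.add ((hD.mul huc).mul huc))
  constructor
  · have j1 : IntervalIntegrable (fun x => f x * (2 * k * u' x)) volume a b :=
      hfi.mul_continuousOn (continuousOn_const.mul hu')
    have j2 : IntervalIntegrable (fun x => (k * u' x) ^ 2) volume a b :=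
      ((continuousOn_const.mul hu').pow 2).intervalIntegrable
    refine ((hf.sub j1).add j2).congr fun x _ => ?_
    ring
  · rw [bilin, bilin, ← intervalIntegral.integral_const_mul, ← intervalIntegral.integral_const_mul,
      ← intervalIntegral.integral_sub i1 (i2.const_mul _),
      ← intervalIntegral.integral_add (i1.sub (i2.const_mul _)) (i3.const_mul _)]
    refine intervalIntegral.integral_congr fun x _ => ?_
    simp only [quadDensity]
    ring

/-- A function that is close to a multiple `k₁ v` on `[a, m]` and to a multiple `k₂ v` on `[m, b]`,
where `v` changes sign at `m`, is small if it is orthogonal to `v` and to a positive function. -/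
lemma exists_abs_le_of_orthogonal {a m b c : ℝ} (ham : a < m) (hmb : m < b) {v R : ℝ → ℝ}
    (hv : ContinuousOn v (Icc a b)) (hR : ContinuousOn R (Icc a b))
    (hRpos : ∀ x ∈ Icc a b, 0 < R x) (hc : 0 < c)
    (hleft : ∀ x ∈ Icc a m, c * (m - x) ≤ v x) (hright : ∀ x ∈ Icc m b, c * (x - m) ≤ -v x) :
    ∃ N > 0, ∀ (F : ℝ → ℝ) (k₁ k₂ s : ℝ), ContinuousOn F (Icc a b) →
      ∫ x in a..b, F x * R x = 0 → ∫ x in a..b, F x * v x = 0 →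
      (∀ x ∈ Icc a m, |F x - k₁ * v x| ≤ s) → (∀ x ∈ Icc m b, |F x - k₂ * v x| ≤ s) →
      ∀ x ∈ Icc a b, |F x| ≤ N * s := by
  have hab : a < b := ham.trans hmb
  have h1 : Icc a m ⊆ Icc a b := Icc_subset_Icc_right hmb.le
  have h2 : Icc m b ⊆ Icc a b := Icc_subset_Icc_left ham.le
  obtain ⟨V, hV⟩ := isCompact_Icc.exists_bound_of_continuousOn hv
  obtain ⟨W, hW⟩ := isCompact_Icc.exists_bound_of_continuousOn hR
  have hV0 : 0 ≤ V := (norm_nonneg _).trans (hV a (left_mem_Icc.2 hab.le))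
  have hW0 : 0 ≤ W := (norm_nonneg _).trans (hW a (left_mem_Icc.2 hab.le))
  have int1 : ∀ f : ℝ → ℝ, ContinuousOn f (Icc a b) → IntervalIntegrable f volume a m := fun f hf =>
    ContinuousOn.intervalIntegrable (by rw [uIcc_of_le ham.le]; exact hf.mono h1)
  have int2 : ∀ f : ℝ → ℝ, ContinuousOn f (Icc a b) → IntervalIntegrable f volume m b := fun f hf =>
    ContinuousOn.intervalIntegrable (by rw [uIcc_of_le hmb.le]; exact hf.mono h2)
  set α₁ := ∫ x in a..m, v x * v x with hα₁
  set β₁ := ∫ x in m..b, v x * v x with hβ₁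
  set α₂ := ∫ x in a..m, v x * R x with hα₂
  set β₂ := -∫ x in m..b, v x * R x with hβ₂
  have vpos : ∀ x ∈ Ioo a m, 0 < v x := fun x hx =>
    (mul_pos hc (sub_pos.2 hx.2)).trans_le (hleft x (Ioo_subset_Icc_self hx))
  have vneg : ∀ x ∈ Ioo m b, 0 < -v x := fun x hx =>
    (mul_pos hc (sub_pos.2 hx.1)).trans_le (hright x (Ioo_subset_Icc_self hx))
  have pα₁ : 0 < α₁ := intervalIntegral.intervalIntegral_pos_of_pos_on (int1 _ (hv.mul hv))
    (fun x hx => mul_pos (vpos x hx) (vpos x hx)) ham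
  have pβ₁ : 0 < β₁ := intervalIntegral.intervalIntegral_pos_of_pos_on (int2 _ (hv.mul hv))
    (fun x hx => by have := mul_pos (vneg x hx) (vneg x hx); rwa [neg_mul_neg] at this) hmb
  have pα₂ : 0 < α₂ := intervalIntegral.intervalIntegral_pos_of_pos_on (int1 _ (hv.mul hR))
    (fun x hx => mul_pos (vpos x hx) (hRpos x (h1 (Ioo_subset_Icc_self hx)))) ham
  have pβ₂ : 0 < β₂ := by
    rw [hβ₂, ← intervalIntegral.integral_neg]
    refine intervalIntegral.intervalIntegral_pos_of_pos_on (int2 _ (hv.mul hR).neg)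
      (fun x hx => ?_) hmb
    have := mul_pos (vneg x hx) (hRpos x (h2 (Ioo_subset_Icc_self hx)))
    rwa [neg_mul] at this
  -- Orthogonality to v and to R gives an approximate linear system for k₁, k₂ with rows (α₁, β₁)
  -- and (α₂, -β₂). Since v² keeps its sign across m while v R changes it, the determinant -Δ is
  -- nonzero.
  set Δ := α₁ * β₂ + β₁ * α₂ with hΔ
  have pΔ : 0 < Δ := by positivity
  have hba : 0 < b - a := sub_pos.2 hab
  -- Cramer's rule bounds k₁ and k₂; the bound is symmetrized so that it serves for both. It is
  -- multiplied by sup |v|, and the 1 accounts for the distance from F to the multiple of v.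
  refine ⟨1 + ((α₂ + β₂) * (V * (b - a)) + (α₁ + β₁) * (W * (b - a))) / Δ * V, by positivity, ?_⟩
  intro F k₁ k₂ s hF hFR hFv hl hr
  have hs : 0 ≤ s := (abs_nonneg _).trans (hl a (left_mem_Icc.2 ham.le))
  -- the two constraints on `k₁` and `k₂`
  have est : ∀ (g : ℝ → ℝ) (G : ℝ), ContinuousOn g (Icc a b) → (∀ x ∈ Icc a b, ‖g x‖ ≤ G) →
      ∫ x in a..b, F x * g x = 0 →
      |k₁ * (∫ x in a..m, v x * g x) + k₂ * ∫ x in m..b, v x * g x| ≤ G * (b - a) * s := by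
    intro g G hg hG h0
    have i1 : IntervalIntegrable (fun x => F x * g x) volume a m := int1 _ (hF.mul hg)
    have i2 : IntervalIntegrable (fun x => F x * g x) volume m b := int2 _ (hF.mul hg)
    have j1 : IntervalIntegrable (fun x => v x * g x) volume a m := int1 _ (hv.mul hg)
    have j2 : IntervalIntegrable (fun x => v x * g x) volume m b := int2 _ (hv.mul hg)
    have e1 : ∫ x in a..m, (F x - k₁ * v x) * g x
        = (∫ x in a..m, F x * g x) - k₁ * ∫ x in a..m, v x * g x := by
      rw [← intervalIntegral.integral_const_mul, ← intervalIntegral.integral_sub i1 (j1.const_mul _)]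
      congr 1; ext x; ring
    have e2 : ∫ x in m..b, (F x - k₂ * v x) * g x
        = (∫ x in m..b, F x * g x) - k₂ * ∫ x in m..b, v x * g x := by
      rw [← intervalIntegral.integral_const_mul, ← intervalIntegral.integral_sub i2 (j2.const_mul _)]
      congr 1; ext x; ring
    rw [← intervalIntegral.integral_add_adjacent_intervals i1 i2] at h0
    have b1 := intervalIntegral.norm_integral_le_of_norm_le_const (a := a) (b := m)
      (f := fun x => (F x - k₁ * v x) * g x) (C := s * G) (fun x hx => by
        rw [uIoc_of_le ham.le] at hx
        have hx' : x ∈ Icc a m := Ioc_subset_Icc_self hx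
        rw [norm_mul]
        exact mul_le_mul (hl x hx') (hG x (h1 hx')) (norm_nonneg _) hs)
    have b2 := intervalIntegral.norm_integral_le_of_norm_le_const (a := m) (b := b)
      (f := fun x => (F x - k₂ * v x) * g x) (C := s * G) (fun x hx => by
        rw [uIoc_of_le hmb.le] at hx
        have hx' : x ∈ Icc m b := Ioc_subset_Icc_self hx
        rw [norm_mul]
        exact mul_le_mul (hr x hx') (hG x (h2 hx')) (norm_nonneg _) hs)
    rw [abs_of_pos (sub_pos.2 ham), e1, Real.norm_eq_abs] at b1
    rw [abs_of_pos (sub_pos.2 hmb), e2, Real.norm_eq_abs] at b2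
    have b3 := abs_add_le ((∫ x in a..m, F x * g x) - k₁ * ∫ x in a..m, v x * g x)
      ((∫ x in m..b, F x * g x) - k₂ * ∫ x in m..b, v x * g x)
    rw [← abs_neg]
    calc |-(k₁ * (∫ x in a..m, v x * g x) + k₂ * ∫ x in m..b, v x * g x)|
        = |((∫ x in a..m, F x * g x) - k₁ * ∫ x in a..m, v x * g x)
          + ((∫ x in m..b, F x * g x) - k₂ * ∫ x in m..b, v x * g x)| := by
          congr 1; linarith
      _ ≤ s * G * (m - a) + s * G * (b - m) := by linarith
      _ = G * (b - a) * s := by ring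
  have X := est v V hv hV hFv
  have Y := est R W hR hW hFR
  rw [← hα₁, ← hβ₁] at X
  rw [← hα₂, show ∫ x in m..b, v x * R x = -β₂ by rw [hβ₂, neg_neg]] at Y
  set ν := V * (b - a) with hν
  set κ := W * (b - a) with hκ
  have pν : 0 ≤ ν := by positivity
  have pκ : 0 ≤ κ := by positivity
  have hk₁ : |k₁| * Δ ≤ ((α₂ + β₂) * ν + (α₁ + β₁) * κ) * s := by
    rw [← abs_of_pos pΔ, ← abs_mul]
    have e : k₁ * Δ = β₂ * (k₁ * α₁ + k₂ * β₁) + β₁ * (k₁ * α₂ + k₂ * -β₂) := by rw [hΔ]; ring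
    rw [e]
    calc _ ≤ |β₂ * (k₁ * α₁ + k₂ * β₁)| + |β₁ * (k₁ * α₂ + k₂ * -β₂)| := abs_add_le _ _
      _ = β₂ * |k₁ * α₁ + k₂ * β₁| + β₁ * |k₁ * α₂ + k₂ * -β₂| := by
        rw [abs_mul, abs_mul, abs_of_pos pβ₂, abs_of_pos pβ₁]
      _ ≤ β₂ * (ν * s) + β₁ * (κ * s) := by gcongr
      _ ≤ (β₂ * (ν * s) + β₁ * (κ * s)) + (α₂ * (ν * s) + α₁ * (κ * s)) :=
        le_add_of_nonneg_right (by positivity)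
      _ = _ := by ring
  have hk₂ : |k₂| * Δ ≤ ((α₂ + β₂) * ν + (α₁ + β₁) * κ) * s := by
    rw [← abs_of_pos pΔ, ← abs_mul]
    have e : k₂ * Δ = α₂ * (k₁ * α₁ + k₂ * β₁) + -(α₁ * (k₁ * α₂ + k₂ * -β₂)) := by rw [hΔ]; ring
    rw [e]
    calc _ ≤ |α₂ * (k₁ * α₁ + k₂ * β₁)| + |-(α₁ * (k₁ * α₂ + k₂ * -β₂))| := abs_add_le _ _
      _ = α₂ * |k₁ * α₁ + k₂ * β₁| + α₁ * |k₁ * α₂ + k₂ * -β₂| := by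
        rw [abs_neg, abs_mul, abs_mul, abs_of_pos pα₂, abs_of_pos pα₁]
      _ ≤ α₂ * (ν * s) + α₁ * (κ * s) := by gcongr
      _ ≤ (α₂ * (ν * s) + α₁ * (κ * s)) + (β₂ * (ν * s) + β₁ * (κ * s)) :=
        le_add_of_nonneg_right (by positivity)
      _ = _ := by ring
  set Z := (α₂ + β₂) * ν + (α₁ + β₁) * κ with hZ
  have fin : ∀ k x : ℝ, |k| * Δ ≤ Z * s → |v x| ≤ V → |F x - k * v x| ≤ s →
      |F x| ≤ (1 + Z / Δ * V) * s := by
    intro k x hk hvx hx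
    have hk' : |k| ≤ Z / Δ * s := by
      rw [div_mul_eq_mul_div, le_div_iff₀ pΔ]
      exact hk
    calc |F x| = |(F x - k * v x) + k * v x| := by ring_nf
      _ ≤ |F x - k * v x| + |k| * |v x| := by rw [← abs_mul]; exact abs_add_le _ _
      _ ≤ s + (Z / Δ * s) * V := by gcongr
      _ = _ := by ring
  intro x hx
  rcases le_total x m with hxm | hxm
  · exact fin k₁ x hk₁ (hV x hx) (hl x ⟨hx.1, hxm⟩)
  · exact fin k₂ x hk₂ (hV x hx) (hr x ⟨hxm, hx.2⟩)

/-- Coercivity on `v^⊥ ∩ R^⊥` of a quadratic form with a null solution `v` that changes sign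
once, given a solution `u` of `L u = lam R` with `lam ∫ u R < 0`. -/
theorem exists_coercive {a m b c lam : ℝ} (ham : a < m) (hmb : m < b)
    {A B D v v' J u u' Ju R : ℝ → ℝ}
    (hA : ContinuousOn A (Icc a b)) (hB : ContinuousOn B (Icc a b)) (hD : ContinuousOn D (Icc a b))
    (hApos : ∀ x ∈ Icc a b, 0 < A x)
    (hv : ∀ x ∈ Icc a b, HasDerivWithinAt v (v' x) (Icc a b) x) (hv' : ContinuousOn v' (Icc a b))
    (hJ : ∀ x ∈ Icc a b, J x = A x * v' x - B x * v x)
    (hJ' : ∀ x ∈ Icc a b, HasDerivWithinAt J (D x * v x - B x * v' x) (Icc a b) x)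
    (hJa : J a = 0) (hJb : J b = 0) (hc : 0 < c)
    (hleft : ∀ x ∈ Icc a m, c * (m - x) ≤ v x) (hright : ∀ x ∈ Icc m b, c * (x - m) ≤ -v x)
    (hu : ∀ x ∈ Icc a b, HasDerivWithinAt u (u' x) (Icc a b) x) (hu' : ContinuousOn u' (Icc a b))
    (hJu : ∀ x ∈ Icc a b, Ju x = A x * u' x - B x * u x)
    (hJu' : ∀ x ∈ Icc a b,
      HasDerivWithinAt Ju (D x * u x - B x * u' x - lam * R x) (Icc a b) x)
    (hJua : Ju a = 0) (hJub : Ju b = 0) (hum : u m ≠ 0)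
    (hR : ContinuousOn R (Icc a b)) (hRpos : ∀ x ∈ Icc a b, 0 < R x)
    (hneg : lam * ∫ x in a..b, u x * R x < 0) :
    ∃ δ > 0, ∀ F f : ℝ → ℝ, HasACDeriv a b F f →
      IntervalIntegrable (fun x => f x ^ 2) volume a b →
      ∫ x in a..b, F x * R x = 0 → ∫ x in a..b, F x * v x = 0 →
      δ * ((∫ x in a..b, F x ^ 2) + ∫ x in a..b, f x ^ 2)
        ≤ ∫ x in a..b, quadDensity A B D F f x := by
  have hab : a < b := ham.trans hmb
  have huab : uIcc a b = Icc a b := uIcc_of_le hab.le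
  have h1 : Icc a m ⊆ Icc a b := Icc_subset_Icc_right hmb.le
  have h2 : Icc m b ⊆ Icc a b := Icc_subset_Icc_left ham.le
  have hmI : m ∈ Icc a b := ⟨ham.le, hmb.le⟩
  have hvc := continuousOn_of_hasDerivWithinAt hv
  have huc := continuousOn_of_hasDerivWithinAt hu
  have hvm : v m = 0 := by
    have e1 := hleft m ⟨ham.le, le_rfl⟩
    have e2 := hright m ⟨le_rfl, hmb.le⟩
    rw [sub_self, mul_zero] at e1 e2
    linarith
  obtain ⟨α, hα, hAα⟩ : ∃ α > 0, ∀ x ∈ Icc a b, α ≤ A x := by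
    obtain ⟨x₀, hx₀, h⟩ := isCompact_Icc.exists_isMinOn ⟨m, hmI⟩ hA
    exact ⟨A x₀, hApos x₀ hx₀, fun x hx => h hx⟩
  obtain ⟨Cv, hCv⟩ := isCompact_Icc.exists_bound_of_continuousOn hv'
  have hlip : ∀ x ∈ Icc a b, |v x| ≤ Cv * |x - m| := by
    intro x hx
    have := (convex_Icc a b).norm_image_sub_le_of_norm_hasDerivWithin_le hv hCv hmI hx
    rwa [hvm, sub_zero, Real.norm_eq_abs, Real.norm_eq_abs] at this
  obtain ⟨K₁, hK₁, left⟩ := exists_sq_sub_le_of_left (C := Cv) ham (hA.mono h1) (hB.mono h1)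
    (hD.mono h1) hα
    (fun x hx => hAα x (h1 hx)) (fun x hx => (hv x (h1 hx)).mono h1) (hv'.mono h1)
    (fun x hx => hJ x (h1 hx)) (fun x hx => (hJ' x (h1 hx)).mono h1) hJa hc hleft
    (fun x hx => by
      have := hlip x (h1 hx)
      rw [abs_of_nonpos (sub_nonpos.2 hx.2), neg_sub] at this
      exact (le_abs_self _).trans this)
  obtain ⟨K₂, hK₂, right⟩ := exists_sq_sub_le_of_right (C := Cv) hmb (hA.mono h2) (hB.mono h2)
    (hD.mono h2) hα
    (fun x hx => hAα x (h2 hx)) (fun x hx => (hv x (h2 hx)).mono h2) (hv'.mono h2)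
    (fun x hx => hJ x (h2 hx)) (fun x hx => (hJ' x (h2 hx)).mono h2) hJb hc hright
    (fun x hx => by
      have := hlip x (h2 hx)
      rw [abs_of_nonneg (sub_nonneg.2 hx.1)] at this
      exact (neg_le_abs _).trans this)
  obtain ⟨N, hN, orth⟩ := exists_abs_le_of_orthogonal ham hmb hvc hR hRpos hc hleft hright
  obtain ⟨U, hU⟩ := isCompact_Icc.exists_bound_of_continuousOn huc
  obtain ⟨b₀, hb₀⟩ := isCompact_Icc.exists_bound_of_continuousOn hB
  obtain ⟨d₀, hd₀⟩ := isCompact_Icc.exists_bound_of_continuousOn hD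
  have hU0 : 0 ≤ U := (norm_nonneg _).trans (hU m hmI)
  have hb0 : 0 ≤ b₀ := (norm_nonneg _).trans (hb₀ m hmI)
  have hd0 : 0 ≤ d₀ := (norm_nonneg _).trans (hd₀ m hmI)
  set μ := -(lam * ∫ x in a..b, u x * R x) with hμdef
  have hμ : 0 < μ := neg_pos.2 hneg
  have hba : 0 < b - a := sub_pos.2 hab
  -- L is the Gårding constant left after absorbing the cross term into half of A f². The bound sup
  -- |F| ≤ n √q is proved below, and Z adds up the L² bounds for F and f that follow from these two.
  set L := 2 * b₀ ^ 2 / α + d₀ with hL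
  set n := N * (U / √μ + √K₁ + √K₂) with hn
  set Z := (b - a) * n ^ 2 + (2 / α) * (1 + L * ((b - a) * n ^ 2)) with hZ
  have hL0 : 0 ≤ L := by positivity
  have hZpos : 0 < Z := by positivity
  refine ⟨1 / Z, by positivity, ?_⟩
  intro F f hF hf hFR hFv
  set q := ∫ x in a..b, quadDensity A B D F f x with hq
  -- The multiple of u is chosen so that F - k u vanishes at m.
  set k := F m / u m with hk
  obtain ⟨hr2, hexp⟩ := integral_quadDensity_sub hab.le hA hB hD hu hu' hF hf k
  have hlR : ContinuousOn (fun x => lam * R x) (Icc a b) := continuousOn_const.mul hR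
  have huAC : HasACDeriv a b u u' := HasACDeriv.of_hasDerivWithinAt hab.le hu hu'
  have pull : ∀ G : ℝ → ℝ, ∫ x in a..b, G x * (lam * R x) = lam * ∫ x in a..b, G x * R x := by
    intro G
    rw [← intervalIntegral.integral_const_mul]
    congr 1; ext x; ring
  -- Pairing with u is lam times integration against R. So the mixed term is zero by F ⊥ R, and the
  -- form at u is -μ < 0: the form at F exceeds the one at F - k u by k² μ.
  rw [bilin_eq_of_solution hab.le hB hD hu hu' hJu hJu' hlR hJua hJub hF,
    bilin_eq_of_solution hab.le hB hD hu hu' hJu hJu' hlR hJua hJub huAC, pull, pull, hFR] at hexp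
  have hrAC : HasACDeriv a b (fun x => F x - k * u x) (fun x => f x - k * u' x) :=
    hF.sub (huAC.const_mul k)
  have hrm : F m - k * u m = 0 := by rw [hk]; field_simp; ring
  have s1 : uIcc a m ⊆ uIcc a b := by rw [huab, uIcc_of_le ham.le]; exact h1
  have s2 : uIcc m b ⊆ uIcc a b := by rw [huab, uIcc_of_le hmb.le]; exact h2
  obtain ⟨k₁, hk₁⟩ := left _ _ (hrAC.mono s1) (hr2.mono_set s1) hrm
  obtain ⟨k₂, hk₂⟩ := right _ _ (hrAC.mono s2) (hr2.mono_set s2) hrm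
  have hqi := intervalIntegrable_quadDensity (huab ▸ hA) (huab ▸ hB) (huab ▸ hD) hrAC hr2
  rw [← intervalIntegral.integral_add_adjacent_intervals (hqi.mono_set s1) (hqi.mono_set s2)]
    at hexp
  set q₁ := ∫ x in a..m, quadDensity A B D (fun x => F x - k * u x) (fun x => f x - k * u' x) x
  set q₂ := ∫ x in m..b, quadDensity A B D (fun x => F x - k * u x) (fun x => f x - k * u' x) x
  have hq₁ : 0 ≤ q₁ := nonneg_of_mul_nonneg_right
    ((sq_nonneg _).trans (hk₁ m ⟨ham.le, le_rfl⟩)) hK₁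
  have hq₂ : 0 ≤ q₂ := nonneg_of_mul_nonneg_right
    ((sq_nonneg _).trans (hk₂ m ⟨le_rfl, hmb.le⟩)) hK₂
  have hqeq : q = q₁ + q₂ + k ^ 2 * μ := by rw [hμdef]; linarith
  have hkμ : 0 ≤ k ^ 2 * μ := by positivity
  have hq0 : 0 ≤ q := by linarith
  set s := √q with hs
  have hkabs : |k| ≤ s / √μ := by
    rw [le_div_iff₀ (Real.sqrt_pos.2 hμ), ← Real.sqrt_sq_eq_abs, ← Real.sqrt_mul (sq_nonneg k)]
    exact Real.sqrt_le_sqrt (by linarith)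
  have near : ∀ (K t k' x : ℝ), 0 < K → t ≤ q → x ∈ Icc a b →
      (F x - k * u x - k' * v x) ^ 2 ≤ K * t → |F x - k' * v x| ≤ (U / √μ + √K) * s := by
    intro K t k' x hK ht hx h
    have e1 : |F x - k * u x - k' * v x| ≤ √K * s := by
      rw [← Real.sqrt_sq_eq_abs, hs, ← Real.sqrt_mul hK.le]
      exact Real.sqrt_le_sqrt (h.trans (by gcongr))
    calc |F x - k' * v x| = |k * u x + (F x - k * u x - k' * v x)| := by ring_nf
      _ ≤ |k| * |u x| + |F x - k * u x - k' * v x| := by rw [← abs_mul]; exact abs_add_le _ _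
      _ ≤ (s / √μ) * U + √K * s := by
        have := hU x hx
        rw [Real.norm_eq_abs] at this
        gcongr
      _ = _ := by ring
  have hs0 : 0 ≤ s := Real.sqrt_nonneg q
  have hFc : ContinuousOn F (Icc a b) := huab ▸ hF.continuousOn
  have sup := orth F k₁ k₂ ((U / √μ + √K₁ + √K₂) * s) hFc hFR hFv
    (fun x hx => (near K₁ q₁ k₁ x hK₁ (by linarith) (h1 hx) (hk₁ x hx)).trans
      (mul_le_mul_of_nonneg_right (by linarith [Real.sqrt_nonneg K₂]) hs0))
    (fun x hx => (near K₂ q₂ k₂ x hK₂ (by linarith) (h2 hx) (hk₂ x hx)).trans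
      (mul_le_mul_of_nonneg_right (by linarith [Real.sqrt_nonneg K₁]) hs0))
  have supsq : ∀ x ∈ Icc a b, F x ^ 2 ≤ n ^ 2 * q := by
    intro x hx
    have e1 := sup x hx
    rw [← mul_assoc, ← hn] at e1
    calc F x ^ 2 = |F x| ^ 2 := (sq_abs _).symm
      _ ≤ (n * s) ^ 2 := by gcongr
      _ = n ^ 2 * q := by rw [mul_pow, hs, Real.sq_sqrt hq0]
  have hF2i : IntervalIntegrable (fun x => F x ^ 2) volume a b := (hF.continuousOn.pow 2).intervalIntegrable
  have hF2 : ∫ x in a..b, F x ^ 2 ≤ (b - a) * n ^ 2 * q := by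
    calc ∫ x in a..b, F x ^ 2 ≤ ∫ _ in a..b, n ^ 2 * q :=
          intervalIntegral.integral_mono_on hab.le hF2i (by simp) supsq
      _ = _ := by simp; ring
  have hgard : α / 2 * (∫ x in a..b, f x ^ 2) ≤ q + L * ∫ x in a..b, F x ^ 2 := by
    have hqF := intervalIntegrable_quadDensity (huab ▸ hA) (huab ▸ hB) (huab ▸ hD) hF hf
    rw [hq, ← intervalIntegral.integral_const_mul, ← intervalIntegral.integral_const_mul,
      ← intervalIntegral.integral_add hqF (hF2i.const_mul _)]
    refine intervalIntegral.integral_mono_on hab.le (hf.const_mul _)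
      (hqF.add (hF2i.const_mul _)) fun x hx => ?_
    have e1 := hAα x hx
    have e2 := hb₀ x hx
    have e3 := hd₀ x hx
    rw [Real.norm_eq_abs] at e2 e3
    have e4 : (B x) ^ 2 ≤ b₀ ^ 2 := by rw [← sq_abs]; gcongr
    have e5 : -d₀ ≤ D x := (abs_le.1 e3).1
    have e6 : 0 ≤ α / 2 * (f x - 2 / α * B x * F x) ^ 2 := by positivity
    have e7 : α / 2 * (f x - 2 / α * B x * F x) ^ 2
        = α / 2 * f x ^ 2 - 2 * B x * F x * f x + 2 / α * B x ^ 2 * F x ^ 2 := by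
      field_simp
      ring
    have e8 : 2 / α * B x ^ 2 * F x ^ 2 ≤ 2 / α * b₀ ^ 2 * F x ^ 2 := by gcongr
    have e9 : α * f x ^ 2 ≤ A x * f x ^ 2 := by gcongr
    have e10 : -d₀ * F x ^ 2 ≤ D x * F x ^ 2 := by gcongr
    have e11 : L * F x ^ 2 = 2 / α * b₀ ^ 2 * F x ^ 2 + d₀ * F x ^ 2 := by rw [hL]; ring
    rw [quadDensity]
    linarith
  have hf2 : ∫ x in a..b, f x ^ 2 ≤ 2 / α * (q + L * ((b - a) * n ^ 2 * q)) := by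
    have e1 : α / 2 * (∫ x in a..b, f x ^ 2) ≤ q + L * ((b - a) * n ^ 2 * q) :=
      hgard.trans (by gcongr)
    calc ∫ x in a..b, f x ^ 2 = 2 / α * (α / 2 * ∫ x in a..b, f x ^ 2) := by field_simp
      _ ≤ _ := by gcongr
  rw [one_div, inv_mul_le_iff₀ hZpos]
  calc _ ≤ (b - a) * n ^ 2 * q + 2 / α * (q + L * ((b - a) * n ^ 2 * q)) := add_le_add hF2 hf2
    _ = Z * q := by rw [hZ]; ring

/-! ### The equilibrium curve, its normal and its translations -/

/-- The equilibrium equation for a profile `ρ` in terms of its derivatives `r₁`, `r₂` and its arc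
length density `s`: the curve has curvature `(P - g y) / σ` at height `y`. -/
structure Profile (g σ γ P : ℝ) (ρ r₁ r₂ s : ℝ → ℝ) : Prop where
  g_pos : 0 < g
  σ_pos : 0 < σ
  γ_lt : -σ < γ
  pos : ∀ θ ∈ Icc 0 Real.pi, 0 < ρ θ
  hasDeriv : ∀ θ ∈ Icc 0 Real.pi, HasDerivWithinAt ρ (r₁ θ) (Icc 0 Real.pi) θ
  hasDeriv₁ : ∀ θ ∈ Icc 0 Real.pi, HasDerivWithinAt r₁ (r₂ θ) (Icc 0 Real.pi) θ
  cont₂ : ContinuousOn r₂ (Icc 0 Real.pi)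
  s_pos : ∀ θ ∈ Icc 0 Real.pi, 0 < s θ
  s_sq : ∀ θ ∈ Icc 0 Real.pi, s θ ^ 2 = ρ θ ^ 2 + r₁ θ ^ 2
  s_deriv : ∀ θ ∈ Icc 0 Real.pi,
    HasDerivWithinAt s (r₁ θ * (ρ θ + r₂ θ) / s θ) (Icc 0 Real.pi) θ
  curvature : ∀ θ ∈ Icc 0 Real.pi, σ * (ρ θ ^ 2 + 2 * r₁ θ ^ 2 - ρ θ * r₂ θ)
    = (P - g * (ρ θ * Real.sin θ)) * s θ ^ 3
  contact_zero : σ * r₁ 0 = -γ * s 0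

namespace Profile

variable {g σ γ P : ℝ} {ρ r₁ r₂ s : ℝ → ℝ}

/-- The vertical component of the outer normal of a polar curve. -/
noncomputable def normalY (ρ r₁ s : ℝ → ℝ) (θ : ℝ) : ℝ :=
  (ρ θ * Real.sin θ - r₁ θ * Real.cos θ) / s θ

/-- The horizontal component of the outer normal of a polar curve. -/
noncomputable def normalX (ρ r₁ s : ℝ → ℝ) (θ : ℝ) : ℝ :=
  (ρ θ * Real.cos θ + r₁ θ * Real.sin θ) / s θ

/-- The height of a point of a polar curve. -/
noncomputable def height (ρ : ℝ → ℝ) (θ : ℝ) : ℝ := ρ θ * Real.sin θ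

/-- The radial variation generated by a horizontal translation. -/
noncomputable def shiftX (ρ r₁ : ℝ → ℝ) (θ : ℝ) : ℝ := Real.cos θ + r₁ θ / ρ θ * Real.sin θ

/-- The derivative of `shiftX`. -/
noncomputable def shiftX' (ρ r₁ r₂ : ℝ → ℝ) (θ : ℝ) : ℝ :=
  -Real.sin θ + ((r₂ θ * ρ θ - r₁ θ * r₁ θ) / ρ θ ^ 2 * Real.sin θ + r₁ θ / ρ θ * Real.cos θ)

/-- The radial variation generated by a vertical translation. -/
noncomputable def shiftY (ρ r₁ : ℝ → ℝ) (θ : ℝ) : ℝ := Real.sin θ - r₁ θ / ρ θ * Real.cos θ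

/-- The derivative of `shiftY`. -/
noncomputable def shiftY' (ρ r₁ r₂ : ℝ → ℝ) (θ : ℝ) : ℝ :=
  Real.cos θ - ((r₂ θ * ρ θ - r₁ θ * r₁ θ) / ρ θ ^ 2 * Real.cos θ + r₁ θ / ρ θ * -Real.sin θ)

/-- The coefficient of `u' v'` in the second variation. -/
noncomputable def coefA (σ : ℝ) (ρ s : ℝ → ℝ) (θ : ℝ) : ℝ := σ * ρ θ ^ 2 / s θ ^ 3

/-- The coefficient of `-(u' v + u v')` in the second variation. -/
noncomputable def coefB (σ : ℝ) (ρ r₁ s : ℝ → ℝ) (θ : ℝ) : ℝ := σ * ρ θ * r₁ θ / s θ ^ 3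

/-- The coefficient of `u v` in the second variation. -/
noncomputable def coefD (g σ : ℝ) (ρ r₁ r₂ s : ℝ → ℝ) (θ : ℝ) : ℝ :=
  g * ρ θ * Real.sin θ + σ * (r₂ θ * ρ θ - r₁ θ ^ 2 - ρ θ ^ 2) / s θ ^ 3

section

variable (h : Profile g σ γ P ρ r₁ r₂ s) {θ : ℝ} (hθ : θ ∈ Icc 0 Real.pi)
include h

lemma cont : ContinuousOn ρ (Icc 0 Real.pi) := continuousOn_of_hasDerivWithinAt h.hasDeriv

lemma cont₁ : ContinuousOn r₁ (Icc 0 Real.pi) := continuousOn_of_hasDerivWithinAt h.hasDeriv₁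

lemma s_cont : ContinuousOn s (Icc 0 Real.pi) := continuousOn_of_hasDerivWithinAt h.s_deriv

lemma coefA_cont : ContinuousOn (coefA σ ρ s) (Icc 0 Real.pi) :=
  (continuousOn_const.mul (h.cont.pow 2)).div (h.s_cont.pow 3)
    fun θ hθ => (pow_pos (h.s_pos θ hθ) 3).ne'

lemma coefB_cont : ContinuousOn (coefB σ ρ r₁ s) (Icc 0 Real.pi) :=
  ((continuousOn_const.mul h.cont).mul h.cont₁).div (h.s_cont.pow 3)
    fun θ hθ => (pow_pos (h.s_pos θ hθ) 3).ne'

lemma coefD_cont : ContinuousOn (coefD g σ ρ r₁ r₂ s) (Icc 0 Real.pi) :=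
  ((continuousOn_const.mul h.cont).mul Real.continuous_sin.continuousOn).add
    ((continuousOn_const.mul (((h.cont₂.mul h.cont).sub (h.cont₁.pow 2)).sub (h.cont.pow 2))).div
      (h.s_cont.pow 3) fun θ hθ => (pow_pos (h.s_pos θ hθ) 3).ne')

lemma shiftX'_cont : ContinuousOn (shiftX' ρ r₁ r₂) (Icc 0 Real.pi) :=
  Real.continuous_sin.continuousOn.neg.add
    (((((h.cont₂.mul h.cont).sub (h.cont₁.mul h.cont₁)).div (h.cont.pow 2)
      fun θ hθ => (pow_pos (h.pos θ hθ) 2).ne').mul Real.continuous_sin.continuousOn).add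
      ((h.cont₁.div h.cont fun θ hθ => (h.pos θ hθ).ne').mul Real.continuous_cos.continuousOn))

lemma shiftY'_cont : ContinuousOn (shiftY' ρ r₁ r₂) (Icc 0 Real.pi) :=
  Real.continuous_cos.continuousOn.sub
    (((((h.cont₂.mul h.cont).sub (h.cont₁.mul h.cont₁)).div (h.cont.pow 2)
      fun θ hθ => (pow_pos (h.pos θ hθ) 2).ne').mul Real.continuous_cos.continuousOn).add
      ((h.cont₁.div h.cont fun θ hθ => (h.pos θ hθ).ne').mul
        Real.continuous_sin.continuousOn.neg))

include hθ

lemma curvature_eq : P - g * height ρ θ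
    = σ * (ρ θ ^ 2 + 2 * r₁ θ ^ 2 - ρ θ * r₂ θ) / s θ ^ 3 := by
  have := (h.s_pos θ hθ).ne'
  rw [h.curvature θ hθ, height]
  field_simp

lemma height_deriv : HasDerivWithinAt (height ρ) (r₁ θ * Real.sin θ + ρ θ * Real.cos θ)
    (Icc 0 Real.pi) θ :=
  (h.hasDeriv θ hθ).fun_mul (Real.hasDerivAt_sin θ).hasDerivWithinAt

lemma height_deriv' : HasDerivWithinAt (height ρ) (normalX ρ r₁ s θ * s θ) (Icc 0 Real.pi) θ := by
  refine (h.height_deriv hθ).congr_deriv (Eq.symm ?_)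
  have := (h.s_pos θ hθ).ne'
  rw [normalX]
  field_simp
  ring

lemma shiftX_deriv : HasDerivWithinAt (shiftX ρ r₁) (shiftX' ρ r₁ r₂ θ) (Icc 0 Real.pi) θ :=
  (Real.hasDerivAt_cos θ).hasDerivWithinAt.fun_add
    (((h.hasDeriv₁ θ hθ).fun_div (h.hasDeriv θ hθ) (h.pos θ hθ).ne').fun_mul
      (Real.hasDerivAt_sin θ).hasDerivWithinAt)

lemma shiftY_deriv : HasDerivWithinAt (shiftY ρ r₁) (shiftY' ρ r₁ r₂ θ) (Icc 0 Real.pi) θ :=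
  (Real.hasDerivAt_sin θ).hasDerivWithinAt.fun_sub
    (((h.hasDeriv₁ θ hθ).fun_div (h.hasDeriv θ hθ) (h.pos θ hθ).ne').fun_mul
      (Real.hasDerivAt_cos θ).hasDerivWithinAt)

lemma shiftX_eq : shiftX ρ r₁ θ = normalX ρ r₁ s θ * s θ / ρ θ := by
  have := (h.s_pos θ hθ).ne'
  have := (h.pos θ hθ).ne'
  rw [normalX, shiftX]
  field_simp

lemma shiftY_eq : shiftY ρ r₁ θ = normalY ρ r₁ s θ * s θ / ρ θ := by
  have := (h.s_pos θ hθ).ne'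
  have := (h.pos θ hθ).ne'
  rw [normalY, shiftY]
  field_simp

lemma normal_sq : normalY ρ r₁ s θ ^ 2 + normalX ρ r₁ s θ ^ 2 = 1 := by
  have := (h.s_pos θ hθ).ne'
  rw [normalX, normalY]
  field_simp
  rw [h.s_sq θ hθ]
  linear_combination (ρ θ ^ 2 + r₁ θ ^ 2) * Real.sin_sq_add_cos_sq θ

/-- The radial unit vector has components ρ/s along the normal and r₁/s along the tangent; the
vertical components of normal and tangent are `normalY` and `normalX`. -/
lemma s_mul_sin : s θ * Real.sin θ = ρ θ * normalY ρ r₁ s θ + r₁ θ * normalX ρ r₁ s θ := by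
  have := (h.s_pos θ hθ).ne'
  rw [normalX, normalY]
  field_simp
  rw [h.s_sq θ hθ]
  ring

/-- With `normalX_deriv` this is Frenet's formula: along the arc the normal turns towards the
tangent at the rate of the curvature (P - g y)/σ. -/
lemma normalY_deriv : HasDerivWithinAt (normalY ρ r₁ s)
    ((P - g * height ρ θ) / σ * normalX ρ r₁ s θ * s θ) (Icc 0 Real.pi) θ := by
  have hs := h.s_pos θ hθ
  have hσ := h.σ_pos
  have h2 := h.s_sq θ hθ
  have d := (((h.hasDeriv θ hθ).fun_mul (Real.hasDerivAt_sin θ).hasDerivWithinAt).fun_sub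
    ((h.hasDeriv₁ θ hθ).fun_mul (Real.hasDerivAt_cos θ).hasDerivWithinAt)).fun_div
    (h.s_deriv θ hθ) hs.ne'
  refine d.congr_deriv (Eq.symm ?_)
  rw [h.curvature_eq hθ, normalX]
  field_simp
  rw [h2]
  ring

lemma normalX_deriv : HasDerivWithinAt (normalX ρ r₁ s)
    (-((P - g * height ρ θ) / σ * normalY ρ r₁ s θ * s θ)) (Icc 0 Real.pi) θ := by
  have hs := h.s_pos θ hθ
  have hσ := h.σ_pos
  have h2 := h.s_sq θ hθ
  have d := (((h.hasDeriv θ hθ).fun_mul (Real.hasDerivAt_cos θ).hasDerivWithinAt).fun_add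
    ((h.hasDeriv₁ θ hθ).fun_mul (Real.hasDerivAt_sin θ).hasDerivWithinAt)).fun_div
    (h.s_deriv θ hθ) hs.ne'
  refine d.congr_deriv (Eq.symm ?_)
  rw [h.curvature_eq hθ, normalY]
  field_simp
  rw [h2]
  ring

/-- The derivative of the cosine of the angle between radius and normal. -/
lemma radial_deriv : HasDerivWithinAt (fun θ => ρ θ / s θ)
    (r₁ θ * ((P - g * height ρ θ) / σ - 1 / s θ)) (Icc 0 Real.pi) θ := by
  have hs := h.s_pos θ hθ
  have hσ := h.σ_pos
  have h2 := h.s_sq θ hθ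
  refine ((h.hasDeriv θ hθ).fun_div (h.s_deriv θ hθ) hs.ne').congr_deriv (Eq.symm ?_)
  rw [h.curvature_eq hθ]
  field_simp
  rw [h2]
  ring

/-- The flux of the horizontal translation. -/
lemma flux_shiftX : -(P - g * height ρ θ) * Real.sin θ
    = coefA σ ρ s θ * shiftX' ρ r₁ r₂ θ - coefB σ ρ r₁ s θ * shiftX ρ r₁ θ := by
  have hs := (h.s_pos θ hθ).ne'
  have hρ := (h.pos θ hθ).ne'
  rw [h.curvature_eq hθ, coefA, coefB, shiftX, shiftX']
  field_simp
  ring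

/-- The flux of the vertical translation. -/
lemma flux_shiftY : (P - g * height ρ θ) * Real.cos θ
    = coefA σ ρ s θ * shiftY' ρ r₁ r₂ θ - coefB σ ρ r₁ s θ * shiftY ρ r₁ θ := by
  have hs := (h.s_pos θ hθ).ne'
  have hρ := (h.pos θ hθ).ne'
  rw [h.curvature_eq hθ, coefA, coefB, shiftY, shiftY']
  field_simp
  ring

lemma pressure_deriv : HasDerivWithinAt (fun θ => P - g * height ρ θ)
    (-(g * (r₁ θ * Real.sin θ + ρ θ * Real.cos θ))) (Icc 0 Real.pi) θ :=
  ((h.height_deriv hθ).const_mul g).const_sub P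

/-- Horizontal translations solve the linearized equation. -/
lemma flux_shiftX_deriv : HasDerivWithinAt (fun θ => -(P - g * height ρ θ) * Real.sin θ)
    (coefD g σ ρ r₁ r₂ s θ * shiftX ρ r₁ θ - coefB σ ρ r₁ s θ * shiftX' ρ r₁ r₂ θ)
    (Icc 0 Real.pi) θ := by
  have hs := (h.s_pos θ hθ).ne'
  have hρ := (h.pos θ hθ).ne'
  refine ((h.pressure_deriv hθ).fun_neg.fun_mul (Real.hasDerivAt_sin θ).hasDerivWithinAt).congr_deriv (Eq.symm ?_)
  rw [h.curvature_eq hθ, coefD, coefB, shiftX, shiftX']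
  field_simp
  ring

/-- Vertical translations solve the linearized equation with right hand side `g`. -/
lemma flux_shiftY_deriv : HasDerivWithinAt (fun θ => (P - g * height ρ θ) * Real.cos θ)
    (coefD g σ ρ r₁ r₂ s θ * shiftY ρ r₁ θ - coefB σ ρ r₁ s θ * shiftY' ρ r₁ r₂ θ - g * ρ θ)
    (Icc 0 Real.pi) θ := by
  have hs := (h.s_pos θ hθ).ne'
  have hρ := (h.pos θ hθ).ne'
  refine ((h.pressure_deriv hθ).fun_mul (Real.hasDerivAt_cos θ).hasDerivWithinAt).congr_deriv (Eq.symm ?_)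
  rw [h.curvature_eq hθ, coefD, coefB, shiftY, shiftY']
  field_simp
  linear_combination (g * ρ θ ^ 2 * s θ ^ 3) * Real.sin_sq_add_cos_sq θ

end

end Profile

/-! ### The first integral, the highest point and the sign of the shift -/

namespace Profile

variable {g σ γ P : ℝ} {ρ r₁ r₂ s : ℝ → ℝ}

lemma zero_mem : (0 : ℝ) ∈ Icc 0 Real.pi := left_mem_Icc.2 Real.pi_pos.le

lemma pi_mem : Real.pi ∈ Icc 0 Real.pi := right_mem_Icc.2 Real.pi_pos.le

lemma height_zero (ρ : ℝ → ℝ) : height ρ 0 = 0 := by simp [height]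

lemma height_pi (ρ : ℝ → ℝ) : height ρ Real.pi = 0 := by simp [height]

section

variable (h : Profile g σ γ P ρ r₁ r₂ s) {θ : ℝ} (hθ : θ ∈ Icc 0 Real.pi)
include h

lemma height_cont : ContinuousOn (height ρ) (Icc 0 Real.pi) :=
  continuousOn_of_hasDerivWithinAt fun _ hθ => h.height_deriv hθ

lemma normalY_cont : ContinuousOn (normalY ρ r₁ s) (Icc 0 Real.pi) :=
  continuousOn_of_hasDerivWithinAt fun _ hθ => h.normalY_deriv hθ

include hθ

lemma height_nonneg : 0 ≤ height ρ θ :=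
  mul_nonneg (h.pos θ hθ).le (Real.sin_nonneg_of_mem_Icc hθ)

/-- The first integral of the equilibrium equation. -/
lemma first_integral :
    σ * normalY ρ r₁ s θ = P * height ρ θ - g * height ρ θ ^ 2 / 2 + γ := by
  have hσ := h.σ_pos
  have d : ∀ t ∈ Icc 0 Real.pi, HasDerivWithinAt
      (fun t => σ * normalY ρ r₁ s t - (P * height ρ t - g * height ρ t ^ 2 / 2)) 0
      (Icc 0 Real.pi) t := by
    intro t ht
    refine (((h.normalY_deriv ht).const_mul σ).fun_sub (((h.height_deriv' ht).const_mul P).fun_sub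
      ((((h.height_deriv' ht).fun_pow 2).const_mul g).div_const 2))).congr_deriv ?_
    field_simp
    ring
  have e := (convex_Icc 0 Real.pi).norm_image_sub_le_of_norm_hasDerivWithin_le (C := 0) d
    (fun _ _ => by simp) zero_mem hθ
  rw [zero_mul, norm_le_zero_iff, sub_eq_zero] at e
  have hs := (h.s_pos 0 zero_mem).ne'
  have e0 : σ * normalY ρ r₁ s 0 = γ := by
    rw [normalY, Real.sin_zero, Real.cos_zero]
    field_simp
    linarith [h.contact_zero]
  rw [height_zero, e0] at e
  linarith

end

/-- `m` is the polar angle of a highest point of the curve. -/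
structure IsTop (ρ r₁ s : ℝ → ℝ) (m : ℝ) : Prop where
  mem : m ∈ Ioo 0 Real.pi
  le : ∀ θ ∈ Icc 0 Real.pi, height ρ θ ≤ height ρ m
  pos : 0 < height ρ m
  normalX_eq : normalX ρ r₁ s m = 0
  normalY_eq : normalY ρ r₁ s m = 1

/-- The height vanishes at both ends and is positive at π/2, so its maximum is interior. There y' =
s X = 0, hence S = ±1, and s sin θ = ρ S > 0 selects the sign. -/
lemma exists_isTop (h : Profile g σ γ P ρ r₁ r₂ s) : ∃ m, IsTop ρ r₁ s m := by
  obtain ⟨m, hm, hmax⟩ := isCompact_Icc.exists_isMaxOn ⟨0, zero_mem⟩ h.height_cont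
  have hhalf : Real.pi / 2 ∈ Icc 0 Real.pi := by
    constructor <;> linarith [Real.pi_pos]
  have hpos : 0 < height ρ m := by
    refine lt_of_lt_of_le ?_ (hmax hhalf)
    simpa [height] using h.pos _ hhalf
  have hmI : m ∈ Ioo 0 Real.pi := by
    refine ⟨lt_of_le_of_ne hm.1 ?_, lt_of_le_of_ne hm.2 ?_⟩
    · rintro rfl
      rw [height_zero] at hpos
      exact lt_irrefl _ hpos
    · rintro rfl
      rw [height_pi] at hpos
      exact lt_irrefl _ hpos
  have hn : Icc 0 Real.pi ∈ 𝓝 m := Icc_mem_nhds hmI.1 hmI.2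
  have hs := h.s_pos m hm
  have hx : normalX ρ r₁ s m = 0 := by
    have := (hmax.isLocalMax hn).hasDerivAt_eq_zero ((h.height_deriv' hm).hasDerivAt hn)
    exact (mul_eq_zero.1 this).resolve_right hs.ne'
  have hy : 0 < normalY ρ r₁ s m := by
    have hsin := Real.sin_pos_of_mem_Ioo hmI
    have e := h.s_mul_sin hm
    rw [hx, mul_zero, add_zero] at e
    exact pos_of_mul_pos_right (e ▸ mul_pos hs hsin) (h.pos m hm).le
  refine ⟨m, hmI, fun θ hθ => hmax hθ, hpos, hx, ?_⟩
  have := h.normal_sq hm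
  rw [hx] at this
  nlinarith

section

variable (h : Profile g σ γ P ρ r₁ r₂ s) {m : ℝ} (ht : IsTop ρ r₁ s m) {θ : ℝ}
  (hθ : θ ∈ Icc 0 Real.pi)
include h ht

lemma top_eq : σ = P * height ρ m - g * height ρ m ^ 2 / 2 + γ := by
  have := h.first_integral (Ioo_subset_Icc_self ht.mem)
  rwa [ht.normalY_eq, mul_one] at this

include hθ in
-- The first integrals at the top and at θ are subtracted. The second factor is the mean of the
-- pressures at the two heights.
lemma one_sub_normalY : σ * (1 - normalY ρ r₁ s θ) = (height ρ m - height ρ θ)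
    * ((P - g * height ρ m) + g * (height ρ m - height ρ θ) / 2) := by
  have e1 := h.first_integral hθ
  have e2 := h.top_eq ht
  linear_combination e2 - e1

/-- The curvature at the top is positive. -/
lemma top_pressure_pos : 0 < P - g * height ρ m := by
  -- If P ≤ g H, then σ (1 - S) ≤ g (H - y)²/2, hence |X| ≤ k (H - y) with k = √(g/σ). Since y' = s
  -- X, the depth H - y then decays at most exponentially, and cannot fall from H > 0 at θ = 0 to
  -- zero at m.
  by_contra! hp
  have hσ := h.σ_pos
  have hg := h.g_pos
  have hsub : Icc 0 m ⊆ Icc 0 Real.pi := Icc_subset_Icc_right ht.mem.2.le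
  obtain ⟨M, hM⟩ := isCompact_Icc.exists_bound_of_continuousOn h.s_cont
  set k := √(g / σ) with hk
  have hX : ∀ t ∈ Icc 0 Real.pi, normalX ρ r₁ s t ≤ k * (height ρ m - height ρ t) := by
    intro t htI
    have hz := sub_nonneg.2 (ht.le t htI)
    have e1 := h.one_sub_normalY ht htI
    have e2 := h.normal_sq htI
    have e3 : normalX ρ r₁ s t ^ 2 ≤ 2 * (1 - normalY ρ r₁ s t) := by nlinarith
    have e4 : σ * (1 - normalY ρ r₁ s t) ≤ g * (height ρ m - height ρ t) ^ 2 / 2 := by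
      rw [e1]
      nlinarith
    refine (le_abs_self _).trans (abs_le_of_sq_le_sq ?_ (by positivity))
    rw [mul_pow, hk, Real.sq_sqrt (by positivity)]
    rw [div_mul_eq_mul_div, le_div_iff₀ hσ]
    nlinarith
  have mono : MonotoneOn
      (fun t => (height ρ m - height ρ t) * Real.exp (k * M * t)) (Icc 0 m) := by
    have d : ∀ t ∈ Icc 0 m, HasDerivWithinAt
        (fun t => (height ρ m - height ρ t) * Real.exp (k * M * t))
        ((-(normalX ρ r₁ s t * s t) + (height ρ m - height ρ t) * (k * M))
          * Real.exp (k * M * t)) (Icc 0 m) t := by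
      intro t htI
      refine (((h.height_deriv' (hsub htI)).const_sub (height ρ m)).mono hsub |>.fun_mul
        (((hasDerivAt_id' t).const_mul (k * M)).exp.hasDerivWithinAt)).congr_deriv ?_
      ring
    refine monotoneOn_of_hasDerivWithinAt_nonneg (convex_Icc 0 m)
      (continuousOn_of_hasDerivWithinAt d)
      (fun t htI => (d t (interior_subset htI)).mono interior_subset) fun t htI => ?_
    have htI' := hsub (interior_subset htI)
    have hs := h.s_pos t htI'
    have hsM : s t ≤ M := (le_abs_self _).trans (hM t htI')
    have hz := sub_nonneg.2 (ht.le t htI')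
    refine mul_nonneg ?_ (Real.exp_pos _).le
    have e1 : normalX ρ r₁ s t * s t ≤ k * (height ρ m - height ρ t) * s t := by
      have := hX t htI'
      gcongr
    have e2 : k * (height ρ m - height ρ t) * s t ≤ k * (height ρ m - height ρ t) * M := by
      gcongr
    linarith
  have := mono (left_mem_Icc.2 ht.mem.1.le) (right_mem_Icc.2 ht.mem.1.le) ht.mem.1.le
  simp only [height_zero, sub_zero, mul_zero, Real.exp_zero, mul_one, sub_self, zero_mul] at this
  exact absurd ht.pos this.not_gt

include hθ

lemma pressure_pos : 0 < P - g * height ρ θ := by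
  have h1 := h.top_pressure_pos ht
  have h2 := mul_nonneg h.g_pos.le (sub_nonneg.2 (ht.le θ hθ))
  linarith

lemma mean_pressure_pos :
    0 < (P - g * height ρ m) + g * (height ρ m - height ρ θ) / 2 := by
  have h1 := h.top_pressure_pos ht
  have h2 := mul_nonneg h.g_pos.le (sub_nonneg.2 (ht.le θ hθ))
  linarith

/-- The first integral reads σ (1 + S) = (σ + γ) + y (P - g y) + g y²/2, and γ > -σ. So the normal
never points straight down, and one may divide by 1 + S. -/
lemma one_add_normalY_pos : 0 < 1 + normalY ρ r₁ s θ := by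
  have e1 := h.first_integral hθ
  have e3 := h.height_nonneg hθ
  have e4 := h.pressure_pos ht hθ
  have e5 := h.γ_lt
  have e6 := mul_nonneg e3 e4.le
  have e7 := mul_nonneg h.g_pos.le (sq_nonneg (height ρ θ))
  have e8 : 0 < σ * (1 + normalY ρ r₁ s θ) := by nlinarith
  exact pos_of_mul_pos_right e8 h.σ_pos.le

/-- From X² = (1 - S)(1 + S). Since the second factor is positive, X² and the depth below the top
can be divided by each other without a singularity. -/
lemma sq_normalX : σ * normalX ρ r₁ s θ ^ 2 = (height ρ m - height ρ θ)
    * (((P - g * height ρ m) + g * (height ρ m - height ρ θ) / 2) * (1 + normalY ρ r₁ s θ)) := by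
  have e1 := h.one_sub_normalY ht hθ
  have e2 := h.normal_sq hθ
  linear_combination σ * e2 + (1 + normalY ρ r₁ s θ) * e1

end

/-- The horizontal translation changes sign at the top, and vanishes there to first order. -/
lemma exists_shiftX_bound (h : Profile g σ γ P ρ r₁ r₂ s) {m : ℝ} (ht : IsTop ρ r₁ s m) :
    ∃ c > 0, (∀ θ ∈ Icc 0 m, c * (m - θ) ≤ shiftX ρ r₁ θ) ∧
      ∀ θ ∈ Icc m Real.pi, c * (θ - m) ≤ -shiftX ρ r₁ θ := by
  have hσ := h.σ_pos
  have hS : ∀ t ∈ Icc 0 Real.pi, 0 < 1 + normalY ρ r₁ s t :=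
    fun t htI => h.one_add_normalY_pos ht htI
  have hSc : ContinuousOn (fun t => 1 + normalY ρ r₁ s t) (Icc 0 Real.pi) :=
    continuousOn_const.add h.normalY_cont
  have lower : ∀ G : ℝ → ℝ, ContinuousOn G (Icc 0 Real.pi) → (∀ t ∈ Icc 0 Real.pi, 0 < G t) →
      ∃ c > 0, ∀ t ∈ Icc 0 Real.pi, c ≤ G t := by
    intro G hG hpos
    obtain ⟨x, hx, hmin⟩ := isCompact_Icc.exists_isMinOn ⟨0, zero_mem⟩ hG
    exact ⟨G x, hpos x hx, fun t htI => hmin htI⟩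
  obtain ⟨c₀, hc₀, hc₀'⟩ := lower
    (fun t => (P - g * height ρ t) / σ * s t / (1 + normalY ρ r₁ s t))
    ((((continuousOn_const.sub (continuousOn_const.mul h.height_cont)).div_const σ).mul
      h.s_cont).div hSc fun t htI => (hS t htI).ne')
    (fun t htI => div_pos (mul_pos (div_pos (h.pressure_pos ht htI) hσ) (h.s_pos t htI)) (hS t htI))
  obtain ⟨c₁, hc₁, hc₁'⟩ := lower (fun t => (1 + normalY ρ r₁ s t) * s t / ρ t)
    ((hSc.mul h.s_cont).div h.cont fun t htI => (h.pos t htI).ne')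
    (fun t htI => div_pos (mul_pos (hS t htI) (h.s_pos t htI)) (h.pos t htI))
  -- X/(1 + S) is the tangent of half the angle between the normal and the vertical. By Frenet's
  -- formulas and X² + S² = 1 its derivative is -(P - g y) s/(σ (1 + S)), which is at most -c₀.
  have anti : AntitoneOn
      (fun t => normalX ρ r₁ s t / (1 + normalY ρ r₁ s t) + c₀ * t) (Icc 0 Real.pi) := by
    have d : ∀ t ∈ Icc 0 Real.pi, HasDerivWithinAt
        (fun t => normalX ρ r₁ s t / (1 + normalY ρ r₁ s t) + c₀ * t)
        (-((P - g * height ρ t) / σ * s t / (1 + normalY ρ r₁ s t)) + c₀) (Icc 0 Real.pi) t := by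
      intro t htI
      refine (((h.normalX_deriv htI).fun_div ((h.normalY_deriv htI).const_add 1)
        (hS t htI).ne').fun_add
        ((hasDerivAt_id' t).const_mul c₀).hasDerivWithinAt).congr_deriv ?_
      have e := h.normal_sq htI
      have := hS t htI
      field_simp
      linear_combination (-(P - g * height ρ t) * s t) * e
    refine antitoneOn_of_hasDerivWithinAt_nonpos (convex_Icc 0 Real.pi)
      (continuousOn_of_hasDerivWithinAt d)
      (fun t htI => (d t (interior_subset htI)).mono interior_subset) fun t htI => ?_
    have := hc₀' t (interior_subset htI)
    linarith
  have hm := Ioo_subset_Icc_self ht.mem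
  have fac : ∀ t ∈ Icc 0 Real.pi, shiftX ρ r₁ t
      = normalX ρ r₁ s t / (1 + normalY ρ r₁ s t) * ((1 + normalY ρ r₁ s t) * s t / ρ t) := by
    intro t htI
    rw [h.shiftX_eq htI]
    have := hS t htI
    have := h.pos t htI
    field_simp
  refine ⟨c₀ * c₁, mul_pos hc₀ hc₁, fun t htI => ?_, fun t htI => ?_⟩
  · have htI' : t ∈ Icc 0 Real.pi := ⟨htI.1, htI.2.trans hm.2⟩
    have e := anti htI' hm htI.2
    simp only [ht.normalX_eq, zero_div, zero_add] at e
    have e1 : c₀ * (m - t) ≤ normalX ρ r₁ s t / (1 + normalY ρ r₁ s t) := by linarith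
    have e2 : 0 ≤ c₀ * (m - t) := mul_nonneg hc₀.le (sub_nonneg.2 htI.2)
    rw [fac t htI']
    calc c₀ * c₁ * (m - t) = c₀ * (m - t) * c₁ := by ring
      _ ≤ _ := mul_le_mul e1 (hc₁' t htI') hc₁.le (e2.trans e1)
  · have htI' : t ∈ Icc 0 Real.pi := ⟨hm.1.trans htI.1, htI.2⟩
    have e := anti hm htI' htI.1
    simp only [ht.normalX_eq, zero_div, zero_add] at e
    have e1 : c₀ * (t - m) ≤ -(normalX ρ r₁ s t / (1 + normalY ρ r₁ s t)) := by linarith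
    have e2 : 0 ≤ c₀ * (t - m) := mul_nonneg hc₀.le (sub_nonneg.2 htI.1)
    rw [fac t htI', ← neg_mul]
    calc c₀ * c₁ * (t - m) = c₀ * (t - m) * c₁ := by ring
      _ ≤ _ := mul_le_mul e1 (hc₁' t htI') hc₁.le (e2.trans e1)

end Profile

/-! ### The auxiliary solution and coercivity for the drop -/

lemma exists_primitive {a b m : ℝ} (hab : a ≤ b) {e : ℝ → ℝ} (he : ContinuousOn e (Icc a b)) :
    ∃ E : ℝ → ℝ, E m = 0 ∧ ∀ x ∈ Icc a b, HasDerivWithinAt E (e x) (Icc a b) x := by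
  have hc : Continuous (IccExtend hab (Set.domRestrict (Icc a b) e)) :=
    (continuousOn_iff_continuous_domRestrict.1 he).Icc_extend'
  refine ⟨fun x => ∫ t in m..x, IccExtend hab (Set.domRestrict (Icc a b) e) t, by simp, ?_⟩
  intro x hx
  have := (hc.integral_hasStrictDerivAt m x).hasDerivAt.hasDerivWithinAt (s := Icc a b)
  rwa [IccExtend_of_mem hab _ hx] at this

namespace Profile

variable {g σ γ P : ℝ} {ρ r₁ r₂ s : ℝ → ℝ}

/-- The mean of the pressures at the top and at the angle `θ`, times `1 + normalY`. -/
noncomputable def topFactor (g P m : ℝ) (ρ r₁ s : ℝ → ℝ) (θ : ℝ) : ℝ :=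
  ((P - g * height ρ m) + g * (height ρ m - height ρ θ) / 2) * (1 + normalY ρ r₁ s θ)

section

variable (h : Profile g σ γ P ρ r₁ r₂ s) {m : ℝ} (ht : IsTop ρ r₁ s m)
include h ht

lemma topFactor_pos {θ : ℝ} (hθ : θ ∈ Icc 0 Real.pi) : 0 < topFactor g P m ρ r₁ s θ :=
  mul_pos (h.mean_pressure_pos ht hθ) (h.one_add_normalY_pos ht hθ)

omit ht in
lemma topFactor_cont : ContinuousOn (topFactor g P m ρ r₁ s) (Icc 0 Real.pi) :=
  (continuousOn_const.add ((continuousOn_const.mul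
    (continuousOn_const.sub h.height_cont)).div_const 2)).mul
    (continuousOn_const.add h.normalY_cont)

lemma pressure_at_top_pos : 0 < P / height ρ m := by
  have h1 := h.top_pressure_pos ht
  have h2 := mul_pos h.g_pos ht.pos
  exact div_pos (by linarith) ht.pos

/-- The depth below the top, divided by `normalX`, is smooth across the top. -/
lemma depth_div_normalX_deriv {θ : ℝ} (hθ : θ ∈ Icc 0 Real.pi) :
    HasDerivWithinAt (fun t => σ * normalX ρ r₁ s t / topFactor g P m ρ r₁ s t)
      (s θ * (-(P - g * height ρ θ) + g * (height ρ m - height ρ θ) * (1 + normalY ρ r₁ s θ) / 2)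
        / topFactor g P m ρ r₁ s θ) (Icc 0 Real.pi) θ := by
  have hG := (h.topFactor_pos ht hθ).ne'
  have hσ := h.σ_pos.ne'
  have dG : HasDerivWithinAt (topFactor g P m ρ r₁ s)
      (g * -(normalX ρ r₁ s θ * s θ) / 2 * (1 + normalY ρ r₁ s θ)
        + ((P - g * height ρ m) + g * (height ρ m - height ρ θ) / 2)
          * ((P - g * height ρ θ) / σ * normalX ρ r₁ s θ * s θ)) (Icc 0 Real.pi) θ :=
    (((((h.height_deriv' hθ).const_sub (height ρ m)).const_mul g).div_const 2).const_add
      (P - g * height ρ m)).fun_mul ((h.normalY_deriv hθ).const_add 1)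
  refine (((h.normalX_deriv hθ).const_mul σ).fun_div dG hG).congr_deriv ?_
  have e1 := h.one_sub_normalY ht hθ
  have e2 := h.normal_sq hθ
  field_simp
  rw [topFactor]
  set C := normalX ρ r₁ s θ
  set S := normalY ρ r₁ s θ
  set y := height ρ θ
  set H := height ρ m
  linear_combination (s θ * (σ * g * (1 + S) / 2
    - ((P - g * H) + g * (H - y) / 2) * (P - g * y))) * 2 * e2 + s θ * g * (1 + S) ^ 2 * e1

/-- A solution of the linearized equation with constant right hand side. -/
lemma exists_solution : ∃ u u' Ju : ℝ → ℝ,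
    (∀ θ ∈ Icc 0 Real.pi, HasDerivWithinAt u (u' θ) (Icc 0 Real.pi) θ) ∧
    ContinuousOn u' (Icc 0 Real.pi) ∧
    (∀ θ ∈ Icc 0 Real.pi, Ju θ = coefA σ ρ s θ * u' θ - coefB σ ρ r₁ s θ * u θ) ∧
    (∀ θ ∈ Icc 0 Real.pi, HasDerivWithinAt Ju
      (coefD g σ ρ r₁ r₂ s θ * u θ - coefB σ ρ r₁ s θ * u' θ - (g - P / height ρ m) * ρ θ)
      (Icc 0 Real.pi) θ) ∧
    Ju 0 = 0 ∧ Ju Real.pi = 0 ∧ 0 < u m ∧ 0 < ∫ θ in (0 : ℝ)..Real.pi, u θ * ρ θ := by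
  -- At the two ends the vertical translation has flux P and -P, and the correction contributes -k H
  -- and k H; this value of k cancels them.
  set k := P / height ρ m with hk
  have hkpos : 0 < k := h.pressure_at_top_pos ht
  -- Reduction of order with v = `shiftX`: the correction v E should satisfy (A v² E')' = k ρ v = k
  -- y'. Integrating from the top gives A v² E' = -k (H - y). Here A v² = σ X²/s, and by
  -- `sq_normalX` the factor H - y cancels, leaving the continuous function `e`.
  set e : ℝ → ℝ := fun θ => -k * s θ / topFactor g P m ρ r₁ s θ with he
  have hec : ContinuousOn e (Icc 0 Real.pi) := (continuousOn_const.mul h.s_cont).div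
    h.topFactor_cont fun θ hθ => (h.topFactor_pos ht hθ).ne'
  obtain ⟨E, hEm, hE⟩ := exists_primitive (m := m) Real.pi_pos.le hec
  have hEc := continuousOn_of_hasDerivWithinAt hE
  have hXc : ContinuousOn (shiftX ρ r₁) (Icc 0 Real.pi) :=
    continuousOn_of_hasDerivWithinAt fun _ hθ => h.shiftX_deriv hθ
  have hYc : ContinuousOn (shiftY ρ r₁) (Icc 0 Real.pi) :=
    continuousOn_of_hasDerivWithinAt fun _ hθ => h.shiftY_deriv hθ
  refine ⟨fun θ => shiftY ρ r₁ θ + shiftX ρ r₁ θ * E θ,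
    fun θ => shiftY' ρ r₁ r₂ θ + (shiftX' ρ r₁ r₂ θ * E θ + shiftX ρ r₁ θ * e θ),
    fun θ => (P - g * height ρ θ) * Real.cos θ
      + (E θ * (-(P - g * height ρ θ) * Real.sin θ)
        + -k * (ρ θ / s θ * (σ * normalX ρ r₁ s θ / topFactor g P m ρ r₁ s θ))),
    fun θ hθ => (h.shiftY_deriv hθ).fun_add ((h.shiftX_deriv hθ).fun_mul (hE θ hθ)),
    h.shiftY'_cont.add ((h.shiftX'_cont.mul hEc).add (hXc.mul hec)), ?_, ?_, ?_, ?_, ?_, ?_⟩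
  · intro θ hθ
    have hs := (h.s_pos θ hθ).ne'
    have hρ := (h.pos θ hθ).ne'
    have hG := (h.topFactor_pos ht hθ).ne'
    have e1 : -k * (ρ θ / s θ * (σ * normalX ρ r₁ s θ / topFactor g P m ρ r₁ s θ))
        = coefA σ ρ s θ * (shiftX ρ r₁ θ * e θ) := by
      rw [h.shiftX_eq hθ, coefA, he]
      field_simp
    simp only [e1, h.flux_shiftX hθ, h.flux_shiftY hθ]
    ring
  · intro θ hθ
    have hs := (h.s_pos θ hθ).ne'
    have hρ := (h.pos θ hθ).ne'
    have hG := (h.topFactor_pos ht hθ).ne'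
    have hσ := h.σ_pos.ne'
    refine ((h.flux_shiftY_deriv hθ).fun_add (((hE θ hθ).fun_mul (h.flux_shiftX_deriv hθ)).fun_add
      (((h.radial_deriv hθ).fun_mul (h.depth_div_normalX_deriv ht hθ)).const_mul
        (-k)))).congr_deriv ?_
    have key : e θ * (-(P - g * height ρ θ) * Real.sin θ)
        + -k * (r₁ θ * ((P - g * height ρ θ) / σ - 1 / s θ)
          * (σ * normalX ρ r₁ s θ / topFactor g P m ρ r₁ s θ)
          + ρ θ / s θ * (s θ * (-(P - g * height ρ θ)
            + g * (height ρ m - height ρ θ) * (1 + normalY ρ r₁ s θ) / 2)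
            / topFactor g P m ρ r₁ s θ))
        = k * ρ θ - coefB σ ρ r₁ s θ * (shiftX ρ r₁ θ * e θ) := by
      have e1 := h.s_mul_sin hθ
      have e2 : topFactor g P m ρ r₁ s θ
        = (P - g * height ρ θ - g * (height ρ m - height ρ θ) / 2) * (1 + normalY ρ r₁ s θ) := by
        rw [topFactor]; ring
      rw [h.shiftX_eq hθ, coefB]
      simp only [he]
      generalize topFactor g P m ρ r₁ s θ = G at *
      field_simp
      rw [e2]
      linear_combination (2 * s θ * (P - g * height ρ θ)) * e1
    linear_combination key
  · have hs := (h.s_pos 0 zero_mem).ne'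
    have hρ := (h.pos 0 zero_mem).ne'
    have hG := (h.topFactor_pos ht zero_mem).ne'
    have hH := ht.pos.ne'
    have e1 := h.sq_normalX ht zero_mem
    have e2 : normalX ρ r₁ s 0 = ρ 0 / s 0 := by simp [normalX]
    rw [← topFactor, height_zero, sub_zero, e2] at e1
    simp only [Real.sin_zero, Real.cos_zero, height_zero, e2, mul_zero, hk]
    field_simp
    field_simp at e1
    linear_combination (-P) * e1
  · have hs := (h.s_pos _ pi_mem).ne'
    have hρ := (h.pos _ pi_mem).ne'
    have hG := (h.topFactor_pos ht pi_mem).ne'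
    have hH := ht.pos.ne'
    have e1 := h.sq_normalX ht pi_mem
    have e2 : normalX ρ r₁ s Real.pi = -(ρ Real.pi / s Real.pi) := by simp [normalX, neg_div]
    rw [← topFactor, height_pi, sub_zero, e2] at e1
    simp only [Real.sin_pi, Real.cos_pi, height_pi, e2, mul_zero, hk]
    field_simp
    field_simp at e1
    linear_combination P * e1
  · have hm := Ioo_subset_Icc_self ht.mem
    simp only [hEm, mul_zero, add_zero, h.shiftY_eq hm, ht.normalY_eq, one_mul]
    exact div_pos (h.s_pos m hm) (h.pos m hm)
  · have hu : uIcc 0 Real.pi = Icc 0 Real.pi := uIcc_of_le Real.pi_pos.le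
    have i1 : IntervalIntegrable (fun θ => shiftY ρ r₁ θ * ρ θ) volume 0 Real.pi :=
      ContinuousOn.intervalIntegrable (hu ▸ hYc.mul h.cont)
    have i2 : IntervalIntegrable (fun θ => shiftX ρ r₁ θ * E θ * ρ θ) volume 0 Real.pi :=
      ContinuousOn.intervalIntegrable (hu ▸ (hXc.mul hEc).mul h.cont)
    have y1 : HasACDeriv 0 Real.pi (height ρ) (fun θ => r₁ θ * Real.sin θ + ρ θ * Real.cos θ) :=
      HasACDeriv.of_hasDerivWithinAt Real.pi_pos.le (fun θ hθ => h.height_deriv hθ)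
        ((h.cont₁.mul Real.continuous_sin.continuousOn).add
          (h.cont.mul Real.continuous_cos.continuousOn))
    have x1 : HasACDeriv 0 Real.pi (fun θ => ρ θ * Real.cos θ)
        (fun θ => r₁ θ * Real.cos θ + ρ θ * -Real.sin θ) :=
      HasACDeriv.of_hasDerivWithinAt Real.pi_pos.le
        (fun θ hθ => (h.hasDeriv θ hθ).fun_mul (Real.hasDerivAt_cos θ).hasDerivWithinAt)
        ((h.cont₁.mul Real.continuous_cos.continuousOn).add
          (h.cont.mul Real.continuous_sin.continuousOn.neg))
    have E1 : HasACDeriv 0 Real.pi E e := HasACDeriv.of_hasDerivWithinAt Real.pi_pos.le hE hec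
    -- The integrand is -(ρ cos θ)'.
    have f1 : ∫ θ in (0 : ℝ)..Real.pi, shiftY ρ r₁ θ * ρ θ = ρ 0 + ρ Real.pi := by
      have := x1.integral_eq_sub
      simp only [Real.cos_zero, Real.cos_pi] at this
      have e3 : ∫ θ in (0 : ℝ)..Real.pi, shiftY ρ r₁ θ * ρ θ
          = ∫ θ in (0 : ℝ)..Real.pi, -(r₁ θ * Real.cos θ + ρ θ * -Real.sin θ) := by
        refine intervalIntegral.integral_congr fun θ hθ => ?_
        have := (h.pos θ (hu ▸ hθ)).ne'
        simp only [shiftY]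
        field_simp
        ring
      rw [e3, intervalIntegral.integral_neg, this]
      ring
    -- As ρ `shiftX` = y' and y vanishes at both ends, integration by parts leaves the integral of
    -- -E' y, where E' = e ≤ 0 ≤ y.
    have f2 : 0 ≤ ∫ θ in (0 : ℝ)..Real.pi, shiftX ρ r₁ θ * E θ * ρ θ := by
      have prod := E1.mul y1
      have i3 : IntervalIntegrable (fun θ => -(e θ * height ρ θ)) volume 0 Real.pi :=
        ContinuousOn.intervalIntegrable (hu ▸ (hec.mul h.height_cont).neg)
      have e3 : ∫ θ in (0 : ℝ)..Real.pi, shiftX ρ r₁ θ * E θ * ρ θ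
          = ∫ θ in (0 : ℝ)..Real.pi, ((e θ * height ρ θ
            + E θ * (r₁ θ * Real.sin θ + ρ θ * Real.cos θ)) + -(e θ * height ρ θ)) := by
        refine intervalIntegral.integral_congr fun θ hθ => ?_
        have := (h.pos θ (hu ▸ hθ)).ne'
        simp only [shiftX]
        field_simp
        ring
      rw [e3, intervalIntegral.integral_add prod.intervalIntegrable i3, prod.integral_eq_sub,
        height_zero, height_pi, mul_zero, mul_zero, sub_zero, zero_add]
      refine intervalIntegral.integral_nonneg Real.pi_pos.le fun θ hθ => ?_
      have h1 := h.height_nonneg hθ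
      have h2 : 0 ≤ k * s θ / topFactor g P m ρ r₁ s θ :=
        div_nonneg (mul_nonneg hkpos.le (h.s_pos θ hθ).le) (h.topFactor_pos ht hθ).le
      have h3 : e θ = -(k * s θ / topFactor g P m ρ r₁ s θ) := by rw [he]; ring
      rw [h3, neg_mul, neg_neg]
      exact mul_nonneg h2 h1
    have e4 : ∫ θ in (0 : ℝ)..Real.pi, (shiftY ρ r₁ θ + shiftX ρ r₁ θ * E θ) * ρ θ
        = (∫ θ in (0 : ℝ)..Real.pi, shiftY ρ r₁ θ * ρ θ)
          + ∫ θ in (0 : ℝ)..Real.pi, shiftX ρ r₁ θ * E θ * ρ θ := by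
      rw [← intervalIntegral.integral_add i1 i2]
      exact intervalIntegral.integral_congr fun θ _ => by ring
    rw [e4, f1]
    linarith [h.pos _ zero_mem, h.pos _ pi_mem]

end

/-- The second variation is coercive on variations orthogonal to `ρ` and to horizontal
translations. -/
theorem exists_coercive (h : Profile g σ γ P ρ r₁ r₂ s) :
    ∃ δ > 0, ∀ F f : ℝ → ℝ, HasACDeriv 0 Real.pi F f →
      IntervalIntegrable (fun x => f x ^ 2) volume 0 Real.pi →
      ∫ x in (0 : ℝ)..Real.pi, F x * ρ x = 0 → ∫ x in (0 : ℝ)..Real.pi, F x * shiftX ρ r₁ x = 0 →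
      δ * ((∫ x in (0 : ℝ)..Real.pi, F x ^ 2) + ∫ x in (0 : ℝ)..Real.pi, f x ^ 2)
        ≤ ∫ x in (0 : ℝ)..Real.pi,
          quadDensity (coefA σ ρ s) (coefB σ ρ r₁ s) (coefD g σ ρ r₁ r₂ s) F f x := by
  obtain ⟨m, ht⟩ := h.exists_isTop
  obtain ⟨c, hc, hl, hr⟩ := h.exists_shiftX_bound ht
  obtain ⟨u, u', Ju, hu, hu', hJu, hJu', hJ0, hJpi, hum, hint⟩ := h.exists_solution ht
  have hH := ht.pos
  refine SessileDrop.exists_coercive (lam := g - P / height ρ m) ht.mem.1 ht.mem.2 h.coefA_cont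
    h.coefB_cont h.coefD_cont ?_ (fun θ hθ => h.shiftX_deriv hθ) h.shiftX'_cont
    (fun θ hθ => h.flux_shiftX hθ) (fun θ hθ => h.flux_shiftX_deriv hθ)
    (by simp) (by simp) hc hl hr hu hu' hJu hJu' hJ0 hJpi hum.ne' h.cont h.pos ?_
  · exact fun θ hθ => div_pos (mul_pos h.σ_pos (pow_pos (h.pos θ hθ) 2)) (pow_pos (h.s_pos θ hθ) 3)
  -- The sign condition g - P/H < 0 is the positivity of the pressure at the top.
  · refine mul_neg_of_neg_of_pos ?_ hint
    rw [sub_neg, lt_div_iff₀ hH]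
    linarith [h.top_pressure_pos ht]

/-- Horizontal translations are in the kernel of the second variation. -/
theorem bilin_shiftX (h : Profile g σ γ P ρ r₁ r₂ s) {F f : ℝ → ℝ}
    (hF : HasACDeriv 0 Real.pi F f) :
    bilin (coefA σ ρ s) (coefB σ ρ r₁ s) (coefD g σ ρ r₁ r₂ s) 0 Real.pi F f
      (shiftX ρ r₁) (shiftX' ρ r₁ r₂) = 0 := by
  rw [bilin_eq_of_solution (R := fun _ => 0) Real.pi_pos.le h.coefB_cont h.coefD_cont
    (fun θ hθ => h.shiftX_deriv hθ) h.shiftX'_cont (fun θ hθ => h.flux_shiftX hθ)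
    (fun θ hθ => by simpa using h.flux_shiftX_deriv hθ) continuousOn_const
    (by simp) (by simp) hF]
  simp

end Profile

/-! ### Functions in H¹ and their absolutely continuous representatives -/

lemma arc_eq : arc = volume.restrict (Ioc 0 Real.pi) := Measure.restrict_congr_set Ioo_ae_eq_Ioc

lemma integral_arc (f : ℝ → ℝ) : ∫ θ, f θ ∂arc = ∫ θ in (0 : ℝ)..Real.pi, f θ := by
  rw [intervalIntegral.integral_of_le Real.pi_pos.le, arc_eq]

lemma intervalIntegrable_iff_arc {f : ℝ → ℝ} :
    IntervalIntegrable f volume 0 Real.pi ↔ Integrable f arc := by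
  rw [intervalIntegrable_iff_integrableOn_Ioc_of_le Real.pi_pos.le, IntegrableOn, arc_eq]

lemma integral_congr_arc {f g : ℝ → ℝ} (h : f =ᵐ[arc] g) :
    ∫ θ in (0 : ℝ)..Real.pi, f θ = ∫ θ in (0 : ℝ)..Real.pi, g θ := by
  rw [← integral_arc, ← integral_arc, integral_congr_ae h]

lemma uIcc_zero_pi : uIcc 0 Real.pi = Icc 0 Real.pi := uIcc_of_le Real.pi_pos.le

lemma hasACDeriv_of_contDiff {φ : ℝ → ℝ} (hφ : ContDiff ℝ ∞ φ) :
    HasACDeriv 0 Real.pi φ (deriv φ) :=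
  HasACDeriv.of_hasDerivWithinAt Real.pi_pos.le
    (fun x _ => ((hφ.differentiable (by simp)) x).hasDerivAt.hasDerivWithinAt)
    (hφ.continuous_deriv (by simp)).continuousOn

lemma HasACDeriv.isWeakDeriv {F f : ℝ → ℝ} (h : HasACDeriv 0 Real.pi F f) : IsWeakDeriv F f := by
  intro φ hφ _ hs
  have hφ' := hasACDeriv_of_contDiff hφ
  have i1 : IntervalIntegrable (fun x => F x * deriv φ x) volume 0 Real.pi :=
    hφ'.intervalIntegrable.continuousOn_mul h.continuousOn
  have i2 : IntervalIntegrable (fun x => f x * φ x) volume 0 Real.pi :=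
    h.intervalIntegrable.mul_continuousOn hφ'.continuousOn
  have e := (h.mul hφ').integral_eq_sub
  have h0 : φ 0 = 0 := image_eq_zero_of_notMem_tsupport fun hm => lt_irrefl _ (hs hm).1
  have hpi : φ Real.pi = 0 := image_eq_zero_of_notMem_tsupport fun hm => lt_irrefl _ (hs hm).2
  rw [intervalIntegral.integral_add i2 i1, h0, hpi] at e
  rw [integral_arc, integral_arc]
  linarith

lemma IsWeakDeriv.congr {f g f' : ℝ → ℝ} (h : IsWeakDeriv f f') (e : f =ᵐ[arc] g) :
    IsWeakDeriv g f' := by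
  intro φ hφ hc hs
  rw [← h φ hφ hc hs]
  refine integral_congr_ae ?_
  filter_upwards [e] with x hx
  rw [hx]

lemma HasACDeriv.memLp {F f : ℝ → ℝ} (h : HasACDeriv 0 Real.pi F f)
    (h2 : IntervalIntegrable (fun x => f x ^ 2) volume 0 Real.pi) : MemLp f 2 arc :=
  (memLp_two_iff_integrable_sq
    (intervalIntegrable_iff_arc.1 h.intervalIntegrable).aestronglyMeasurable).2
    (intervalIntegrable_iff_arc.1 h2)

lemma HasACDeriv.memLp_self {F f : ℝ → ℝ} (h : HasACDeriv 0 Real.pi F f) : MemLp F 2 arc :=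
  (memLp_two_iff_integrable_sq
    (intervalIntegrable_iff_arc.1 h.continuousOn.intervalIntegrable).aestronglyMeasurable).2
    (intervalIntegrable_iff_arc.1 (h.continuousOn.pow 2).intervalIntegrable)

/-- The lemma of du Bois-Reymond: a function with vanishing weak derivative is constant. -/
lemma IsWeakDeriv.ae_const {d : ℝ → ℝ} (hd : Integrable d arc)
    (h : IsWeakDeriv d fun _ => 0) : ∃ c : ℝ, d =ᵐ[arc] fun _ => c := by
  have hball : Metric.ball (Real.pi / 2) (Real.pi / 2) = Ioo 0 Real.pi := by
    rw [Real.ball_eq_Ioo]; congr 1 <;> ring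
  have hpi := Real.pi_pos
  let b : ContDiffBump (Real.pi / 2 : ℝ) :=
    { rIn := Real.pi / 8, rOut := Real.pi / 4, rIn_pos := by positivity, rIn_lt_rOut := by linarith }
  set β : ℝ → ℝ := b.normed volume with hβ
  have hβs : ContDiff ℝ ∞ β := b.contDiff_normed
  have hβc : HasCompactSupport β := b.hasCompactSupport_normed
  have hβt : tsupport β ⊆ Ioo 0 Real.pi := by
    rw [hβ, b.tsupport_normed_eq, ← hball]
    exact Metric.closedBall_subset_ball (by change Real.pi / 4 < Real.pi / 2; linarith)
  have hβ1 : ∫ x, β x = 1 := b.integral_normed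
  have bdd : ∀ φ : ℝ → ℝ, ContDiff ℝ ∞ φ → HasCompactSupport φ →
      Integrable (fun x => d x * φ x) arc := by
    intro φ hφ hc
    obtain ⟨C, hC⟩ := hc.exists_bound_of_continuous hφ.continuous
    exact hd.mul_bdd (c := C) hφ.continuous.aestronglyMeasurable (ae_of_all _ hC)
  have inter : ∀ φ : ℝ → ℝ, tsupport φ ⊆ Ioo 0 Real.pi →
      ∫ x in (0 : ℝ)..Real.pi, φ x = ∫ x, φ x := by
    intro φ hs
    rw [← integral_arc]
    refine setIntegral_eq_integral_of_forall_compl_eq_zero fun x hx => ?_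
    exact image_eq_zero_of_notMem_tsupport fun hm => hx (hs hm)
  set c := ∫ x, d x * β x ∂arc with hc
  refine ⟨c, ?_⟩
  -- The function φ - (∫ φ) β has mean zero, so its primitive from 0 vanishes near both ends and is
  -- itself an admissible test function. Testing with it shows that d acts on φ as the constant c.
  have key : ∀ φ : ℝ → ℝ, ContDiff ℝ ∞ φ → HasCompactSupport φ → tsupport φ ⊆ Ioo 0 Real.pi →
      ∫ x, d x * φ x ∂arc = c * ∫ x, φ x := by
    intro φ hφ hφc hφt
    set k := ∫ x, φ x with hk
    set χ : ℝ → ℝ := fun x => φ x - k * β x with hχ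
    have hχs : ContDiff ℝ ∞ χ := hφ.sub (contDiff_const.mul hβs)
    have hχcont := hχs.continuous
    set ψ : ℝ → ℝ := fun x => ∫ t in (0 : ℝ)..x, χ t with hψ
    have hψd : ∀ x, HasDerivAt ψ (χ x) x := fun x =>
      (hχcont.integral_hasStrictDerivAt 0 x).hasDerivAt
    have hψ' : deriv ψ = χ := funext fun x => (hψd x).deriv
    have hψs : ContDiff ℝ ∞ ψ := by
      rw [contDiff_infty_iff_deriv, hψ']
      exact ⟨fun x => (hψd x).differentiableAt, hχs⟩
    obtain ⟨r, hr, hrs⟩ := exists_lt_subset_ball (x := Real.pi / 2) (r := Real.pi / 2)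
      (s := tsupport φ ∪ tsupport β) ((isClosed_tsupport _).union (isClosed_tsupport _))
      (hball ▸ union_subset hφt hβt)
    have hχ0 : ∀ x, x ∉ Metric.ball (Real.pi / 2) r → χ x = 0 := by
      intro x hx
      have h1 : φ x = 0 := image_eq_zero_of_notMem_tsupport fun hm => hx (hrs (Or.inl hm))
      have h2 : β x = 0 := image_eq_zero_of_notMem_tsupport fun hm => hx (hrs (Or.inr hm))
      simp only [hχ, h1, h2, mul_zero, sub_zero]
    have hχint : ∫ t in (0 : ℝ)..Real.pi, χ t = 0 := by
      have i1 : IntervalIntegrable φ volume 0 Real.pi := hφ.continuous.intervalIntegrable _ _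
      have i2 : IntervalIntegrable β volume 0 Real.pi := hβs.continuous.intervalIntegrable _ _
      rw [hχ, intervalIntegral.integral_sub i1 (i2.const_mul k),
        intervalIntegral.integral_const_mul, inter φ hφt, inter β hβt, hβ1]
      ring
    have hψ0 : ∀ x, x ∉ Metric.closedBall (Real.pi / 2) r → ψ x = 0 := by
      intro x hx
      rw [Real.closedBall_eq_Icc, mem_Icc, not_and_or, not_le, not_le] at hx
      have zero : ∀ a e : ℝ, (∀ t ∈ uIcc a e, t ∉ Metric.ball (Real.pi / 2) r) →
          ∫ t in a..e, χ t = 0 := by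
        intro a e hae
        rw [intervalIntegral.integral_congr (g := fun _ => (0 : ℝ)) fun t htm => hχ0 t (hae t htm)]
        simp
      rcases hx with hx | hx
      · refine zero 0 x fun t htm hb => ?_
        rw [Real.ball_eq_Ioo] at hb
        have : t ≤ max 0 x := htm.2
        rcases le_max_iff.1 this with h1 | h1 <;> linarith [hb.1]
      · have h1 : ψ x = (∫ t in (0 : ℝ)..Real.pi, χ t) + ∫ t in Real.pi..x, χ t :=
          (intervalIntegral.integral_add_adjacent_intervals (hχcont.intervalIntegrable _ _)
            (hχcont.intervalIntegrable _ _)).symm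
        rw [h1, hχint, zero_add]
        refine zero Real.pi x fun t htm hb => ?_
        rw [Real.ball_eq_Ioo] at hb
        have : min Real.pi x ≤ t := htm.1
        rcases min_le_iff.1 this with h1 | h1 <;> linarith [hb.2]
    have hψt : tsupport ψ ⊆ Metric.closedBall (Real.pi / 2) r :=
      closure_minimal (fun x hx => by_contra fun hn => hx (hψ0 x hn)) Metric.isClosed_closedBall
    have hψc : HasCompactSupport ψ :=
      (isCompact_closedBall _ _).of_isClosed_subset (isClosed_tsupport _) hψt
    have e := h ψ hψs hψc (hψt.trans (hball ▸ Metric.closedBall_subset_ball hr))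
    simp only [zero_mul, integral_zero, neg_zero, hψ'] at e
    have e2 : ∫ x, d x * χ x ∂arc = (∫ x, d x * φ x ∂arc) - k * c := by
      rw [hc, ← integral_const_mul, ← integral_sub (bdd φ hφ hφc) ((bdd β hβs hβc).const_mul k)]
      exact integral_congr_ae (ae_of_all _ fun x => by simp only [hχ]; ring)
    linarith
  have hloc : LocallyIntegrableOn (fun x => d x - c) (Ioo 0 Real.pi) :=
    (show IntegrableOn (fun x => d x - c) (Ioo 0 Real.pi) volume from
      Integrable.sub (μ := arc) hd (integrable_const c)).locallyIntegrableOn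
  have := isOpen_Ioo.ae_eq_zero_of_integral_contDiff_smul_eq_zero hloc (by
    intro φ hφ hφc hφt
    have e3 : ∫ x, φ x • (d x - c) = ∫ x, φ x • (d x - c) ∂arc := by
      refine (setIntegral_eq_integral_of_forall_compl_eq_zero fun x hx => ?_).symm
      rw [image_eq_zero_of_notMem_tsupport fun hm => hx (hφt hm), zero_smul]
    have hφi : Integrable φ arc :=
      intervalIntegrable_iff_arc.1 (hφ.continuous.intervalIntegrable _ _)
    have e4 : ∫ x, φ x • (d x - c) ∂arc = (∫ x, d x * φ x ∂arc) - c * ∫ x, φ x ∂arc := by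
      rw [← integral_const_mul, ← integral_sub (bdd φ hφ hφc) (hφi.const_mul c)]
      exact integral_congr_ae (ae_of_all _ fun x => by simp only [smul_eq_mul]; ring)
    rw [e3, e4, key φ hφ hφc hφt, integral_arc, inter φ hφt, sub_self])
  rw [Filter.EventuallyEq, ae_restrict_iff' measurableSet_Ioo]
  filter_upwards [this] with x hx hm
  exact sub_eq_zero.1 (hx hm)

/-- `U` is the absolutely continuous representative of `u ∈ H¹(0, π)`, with derivative `u'`. -/
structure IsRep (u U u' : ℝ → ℝ) : Prop where
  ac : HasACDeriv 0 Real.pi U u'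
  sq : IntervalIntegrable (fun x => u' x ^ 2) volume 0 Real.pi
  ae_eq : u =ᵐ[arc] U
  weakDeriv_ae_eq : weakDeriv u =ᵐ[arc] u'

namespace IsRep

variable {u U u' v V v' : ℝ → ℝ}

/-- `weakDeriv` is an arbitrary choice, so it is identified with the almost everywhere derivative
through uniqueness of weak derivatives. -/
lemma mk' (h : HasACDeriv 0 Real.pi U u')
    (h2 : IntervalIntegrable (fun x => u' x ^ 2) volume 0 Real.pi) (e : u =ᵐ[arc] U) :
    IsRep u U u' where
  ac := h
  sq := h2
  ae_eq := e
  weakDeriv_ae_eq := by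
    have hw : IsWeakDeriv u u' := h.isWeakDeriv.congr e.symm
    have hm : MemH1 u := ⟨(memLp_congr_ae e).2 h.memLp_self, u', h.memLp h2, hw⟩
    exact hm.weakDeriv_spec.2.ae_unique hm.weakDeriv_spec.1 (h.memLp h2) hw

/-- A continuously differentiable function represents itself. -/
lemma of_hasDerivWithinAt
    (h : ∀ x ∈ Icc 0 Real.pi, HasDerivWithinAt U (u' x) (Icc 0 Real.pi) x)
    (hc : ContinuousOn u' (Icc 0 Real.pi)) : IsRep U U u' :=
  mk' (HasACDeriv.of_hasDerivWithinAt Real.pi_pos.le h hc)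
    (ContinuousOn.intervalIntegrable (uIcc_zero_pi ▸ hc.pow 2)) (ae_eq_refl _)

lemma sub_const_mul (h : IsRep u U u') (k : IsRep v V v') (a : ℝ) :
    IsRep (fun x => u x - a * v x) (fun x => U x - a * V x) (fun x => u' x - a * v' x) := by
  refine mk' (h.ac.sub (k.ac.const_mul a)) ?_ ?_
  · have h1 := h.ac.memLp h.sq
    have h2 := k.ac.memLp k.sq
    have := (h1.sub (h2.const_mul a)).integrable_sq
    exact intervalIntegrable_iff_arc.2 this
  · filter_upwards [h.ae_eq, k.ae_eq] with x hx kx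
    rw [hx, kx]

lemma normH1_sq (h : IsRep u U u') : normH1 u ^ 2
    = (∫ x in (0 : ℝ)..Real.pi, U x ^ 2) + ∫ x in (0 : ℝ)..Real.pi, u' x ^ 2 := by
  have e1 : ∫ x in (0 : ℝ)..Real.pi, u x ^ 2 = ∫ x in (0 : ℝ)..Real.pi, U x ^ 2 :=
    integral_congr_arc (by filter_upwards [h.ae_eq] with x hx; rw [hx])
  have e2 : ∫ x in (0 : ℝ)..Real.pi, weakDeriv u x ^ 2 = ∫ x in (0 : ℝ)..Real.pi, u' x ^ 2 :=
    integral_congr_arc (by filter_upwards [h.weakDeriv_ae_eq] with x hx; rw [hx])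
  rw [normH1, e1, e2, Real.sq_sqrt]
  exact add_nonneg (intervalIntegral.integral_nonneg Real.pi_pos.le fun _ _ => sq_nonneg _)
    (intervalIntegral.integral_nonneg Real.pi_pos.le fun _ _ => sq_nonneg _)

end IsRep

/-- The difference of u and the primitive of its weak derivative has weak derivative zero, hence is
a constant; this constant becomes the initial value of the primitive. -/
lemma MemH1.exists_isRep {u : ℝ → ℝ} (h : MemH1 u) : ∃ U, IsRep u U (weakDeriv u) := by
  obtain ⟨hL, hw⟩ := h.weakDeriv_spec
  have hi : IntervalIntegrable (weakDeriv u) volume 0 Real.pi :=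
    intervalIntegrable_iff_arc.2 (hL.integrable (by norm_num))
  have hF := HasACDeriv.of_intervalIntegrable hi 0
  set F : ℝ → ℝ := fun x => 0 + ∫ t in (0 : ℝ)..x, weakDeriv u t with hFdef
  have hui : Integrable u arc := h.1.integrable (by norm_num)
  have hFi : Integrable F arc :=
    intervalIntegrable_iff_arc.1 hF.continuousOn.intervalIntegrable
  have hd : IsWeakDeriv (fun x => u x - F x) fun _ => 0 := by
    intro φ hφ hc hs
    obtain ⟨C, hC⟩ := (hc.deriv).exists_bound_of_continuous (hφ.continuous_deriv (by simp))
    have hm := (hφ.continuous_deriv (by simp)).aestronglyMeasurable (μ := arc)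
    have i1 : Integrable (fun x => u x * deriv φ x) arc := hui.mul_bdd (c := C) hm (ae_of_all _ hC)
    have i2 : Integrable (fun x => F x * deriv φ x) arc := hFi.mul_bdd (c := C) hm (ae_of_all _ hC)
    simp only [sub_mul, zero_mul, integral_zero, neg_zero]
    rw [integral_sub i1 i2, hw φ hφ hc hs, hF.isWeakDeriv φ hφ hc hs, sub_self]
  obtain ⟨c, hc⟩ := hd.ae_const (hui.sub hFi)
  refine ⟨_, IsRep.mk' (HasACDeriv.of_intervalIntegrable hi c)
    (intervalIntegrable_iff_arc.2 hL.integrable_sq) ?_⟩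
  filter_upwards [hc] with x hx
  simp only [hFdef, Pi.sub_apply] at hx
  linarith

/-! ### The second variation on H¹ -/

/-- An equilibrium satisfies the curvature equation. -/
lemma IsEquilibrium.profile {g σ γ V P₀ : ℝ} {ρ₀ : ℝ → ℝ} (hg : 0 < g) (hσ : 0 < σ)
    (hγ : |γ| < σ) (h : IsEquilibrium g σ γ V P₀ ρ₀) :
    Profile g σ γ P₀ ρ₀ (dθ ρ₀) (dθ (dθ ρ₀)) (speed ρ₀) := by
  have hU : UniqueDiffOn ℝ (Icc 0 Real.pi) := uniqueDiffOn_Icc Real.pi_pos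
  have d1 : ∀ θ ∈ Icc 0 Real.pi, HasDerivWithinAt ρ₀ (dθ ρ₀ θ) (Icc 0 Real.pi) θ := fun θ hθ =>
    (h.contDiffOn.differentiableOn (by norm_num) θ hθ).hasDerivWithinAt
  have c1 : ContDiffOn ℝ 1 (dθ ρ₀) (Icc 0 Real.pi) :=
    h.contDiffOn.derivWithin hU (by norm_num)
  have d2 : ∀ θ ∈ Icc 0 Real.pi, HasDerivWithinAt (dθ ρ₀) (dθ (dθ ρ₀) θ) (Icc 0 Real.pi) θ :=
    fun θ hθ => (c1.differentiableOn (by norm_num) θ hθ).hasDerivWithinAt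
  have c2 : ContinuousOn (dθ (dθ ρ₀)) (Icc 0 Real.pi) := c1.continuousOn_derivWithin hU (by norm_num)
  have rad : ∀ θ ∈ Icc 0 Real.pi, 0 < ρ₀ θ ^ 2 + dθ ρ₀ θ ^ 2 := fun θ hθ => by
    have := h.pos θ hθ
    positivity
  have sp : ∀ θ ∈ Icc 0 Real.pi, 0 < speed ρ₀ θ := fun θ hθ => Real.sqrt_pos.2 (rad θ hθ)
  have ss : ∀ θ ∈ Icc 0 Real.pi, speed ρ₀ θ ^ 2 = ρ₀ θ ^ 2 + dθ ρ₀ θ ^ 2 := fun θ hθ =>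
    Real.sq_sqrt (rad θ hθ).le
  have sd : ∀ θ ∈ Icc 0 Real.pi, HasDerivWithinAt (speed ρ₀)
      (dθ ρ₀ θ * (ρ₀ θ + dθ (dθ ρ₀) θ) / speed ρ₀ θ) (Icc 0 Real.pi) θ := by
    intro θ hθ
    have e := (((d1 θ hθ).fun_pow 2).fun_add ((d2 θ hθ).fun_pow 2)).sqrt (rad θ hθ).ne'
    refine e.congr_deriv ?_
    have : 0 < √(ρ₀ θ ^ 2 + dθ ρ₀ θ ^ 2) := sp θ hθ
    rw [speed]
    field_simp
    norm_num
    ring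
  refine ⟨hg, hσ, (abs_lt.1 hγ).1, h.pos, d1, d2, c2, sp, ss, sd, ?_, ?_⟩
  · intro θ hθ
    have e := h.eulerLagrange θ hθ
    have hs := (sp θ hθ).ne'
    have e2 : dθ (fun τ => dθ ρ₀ τ / speed ρ₀ τ) θ = _ :=
      ((d2 θ hθ).fun_div (sd θ hθ) hs).derivWithin (hU θ hθ)
    have hρ := (h.pos θ hθ).ne'
    have s2 := ss θ hθ
    rw [e2] at e
    -- The surface terms of the Euler-Lagrange equation are ρ₀ times σ times the curvature, so
    -- dividing by ρ₀ > 0 leaves the curvature equation.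
    have e3 : σ * (ρ₀ θ / speed ρ₀ θ) - σ * ((dθ (dθ ρ₀) θ * speed ρ₀ θ
        - dθ ρ₀ θ * (dθ ρ₀ θ * (ρ₀ θ + dθ (dθ ρ₀) θ) / speed ρ₀ θ)) / speed ρ₀ θ ^ 2)
        = ρ₀ θ * (σ * (ρ₀ θ ^ 2 + 2 * dθ ρ₀ θ ^ 2 - ρ₀ θ * dθ (dθ ρ₀) θ)) / speed ρ₀ θ ^ 3 := by
      field_simp
      rw [s2]
      ring
    have e4 : ρ₀ θ * (σ * (ρ₀ θ ^ 2 + 2 * dθ ρ₀ θ ^ 2 - ρ₀ θ * dθ (dθ ρ₀) θ)) / speed ρ₀ θ ^ 3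
        = ρ₀ θ * (P₀ - g * (ρ₀ θ * Real.sin θ)) := by
      rw [← e3]
      linarith
    rw [div_eq_iff (pow_ne_zero 3 hs), mul_assoc] at e4
    exact mul_left_cancel₀ hρ e4
  · have hs := (sp 0 (left_mem_Icc.2 Real.pi_pos.le)).ne'
    have e := h.contact_right
    field_simp at e
    linarith

lemma IsRep.memLp {u U u' : ℝ → ℝ} (h : IsRep u U u') : MemLp u 2 arc :=
  (memLp_congr_ae h.ae_eq).2 h.ac.memLp_self

lemma IsRep.memH1 {u U u' : ℝ → ℝ} (h : IsRep u U u') : MemH1 u :=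
  ⟨h.memLp, u', h.ac.memLp h.sq, h.ac.isWeakDeriv.congr h.ae_eq.symm⟩

section

variable {g σ γ P : ℝ} {ρ : ℝ → ℝ}
  (hp : Profile g σ γ P ρ (dθ ρ) (dθ (dθ ρ)) (speed ρ)) {u U u' v V v' : ℝ → ℝ}
include hp

/-- Functions and weak derivatives enter only up to null sets, so the representatives may be
substituted; each of the five integrals then converges and they merge into one. -/
lemma innerSigma_eq_bilin (hu : IsRep u U u') (hv : IsRep v V v') :
    innerSigma g σ ρ u v = bilin (Profile.coefA σ ρ (speed ρ)) (Profile.coefB σ ρ (dθ ρ) (speed ρ))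
      (Profile.coefD g σ ρ (dθ ρ) (dθ (dθ ρ)) (speed ρ)) 0 Real.pi U u' V v' := by
  have ρc := uIcc_zero_pi ▸ hp.cont
  have r₁c := uIcc_zero_pi ▸ hp.cont₁
  have r₂c := uIcc_zero_pi ▸ hp.cont₂
  have sc := uIcc_zero_pi ▸ hp.s_cont.pow 3
  have sne : ∀ x ∈ uIcc 0 Real.pi, speed ρ x ^ 3 ≠ 0 := fun x hx =>
    (pow_pos (hp.s_pos x (uIcc_zero_pi ▸ hx)) 3).ne'
  have Uc := hu.ac.continuousOn
  have Vc := hv.ac.continuousOn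
  have i1 : IntervalIntegrable (fun θ => ρ θ * U θ * V θ * Real.sin θ) volume 0 Real.pi :=
    (((ρc.mul Uc).mul Vc).mul Real.continuous_sin.continuousOn).intervalIntegrable
  have i2 : IntervalIntegrable (fun θ => ρ θ ^ 2 * u' θ * v' θ / speed ρ θ ^ 3)
      volume 0 Real.pi := by
    have h0 : IntervalIntegrable (fun θ => u' θ * v' θ) volume 0 Real.pi :=
      intervalIntegrable_iff_arc.2 ((hu.ac.memLp hu.sq).integrable_mul (hv.ac.memLp hv.sq))
    refine (h0.continuousOn_mul ((ρc.pow 2).div sc sne)).congr fun x _ => ?_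
    simp only [Pi.div_apply, Pi.pow_apply]
    ring
  have i3 : IntervalIntegrable (fun θ => ρ θ * dθ ρ θ * u' θ * V θ / speed ρ θ ^ 3)
      volume 0 Real.pi := by
    refine (hu.ac.intervalIntegrable.continuousOn_mul
      (((ρc.mul r₁c).mul Vc).div sc sne)).congr fun x _ => ?_
    simp only [Pi.div_apply, Pi.mul_apply, Pi.pow_apply]
    ring
  have i4 : IntervalIntegrable (fun θ => ρ θ * dθ ρ θ * U θ * v' θ / speed ρ θ ^ 3)
      volume 0 Real.pi := by
    refine (hv.ac.intervalIntegrable.continuousOn_mul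
      (((ρc.mul r₁c).mul Uc).div sc sne)).congr fun x _ => ?_
    simp only [Pi.div_apply, Pi.mul_apply, Pi.pow_apply]
    ring
  have i5 : IntervalIntegrable (fun θ =>
      (dθ (dθ ρ) θ * ρ θ - dθ ρ θ ^ 2 - ρ θ ^ 2) / speed ρ θ ^ 3 * U θ * V θ) volume 0 Real.pi :=
    ((((((r₂c.mul ρc).sub (r₁c.pow 2)).sub (ρc.pow 2)).div sc sne).mul Uc).mul
      Vc).intervalIntegrable
  have e1 : ∫ θ in (0 : ℝ)..Real.pi, ρ θ * u θ * v θ * Real.sin θ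
      = ∫ θ in (0 : ℝ)..Real.pi, ρ θ * U θ * V θ * Real.sin θ := integral_congr_arc (by
    filter_upwards [hu.ae_eq, hv.ae_eq] with x h1 h2; rw [h1, h2])
  have e2 : ∫ θ in (0 : ℝ)..Real.pi, ρ θ ^ 2 * weakDeriv u θ * weakDeriv v θ / speed ρ θ ^ 3
      = ∫ θ in (0 : ℝ)..Real.pi, ρ θ ^ 2 * u' θ * v' θ / speed ρ θ ^ 3 := integral_congr_arc (by
    filter_upwards [hu.weakDeriv_ae_eq, hv.weakDeriv_ae_eq] with x h1 h2; rw [h1, h2])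
  have e3 : ∫ θ in (0 : ℝ)..Real.pi, ρ θ * dθ ρ θ * weakDeriv u θ * v θ / speed ρ θ ^ 3
      = ∫ θ in (0 : ℝ)..Real.pi, ρ θ * dθ ρ θ * u' θ * V θ / speed ρ θ ^ 3 :=
    integral_congr_arc (by
      filter_upwards [hu.weakDeriv_ae_eq, hv.ae_eq] with x h1 h2; rw [h1, h2])
  have e4 : ∫ θ in (0 : ℝ)..Real.pi, ρ θ * dθ ρ θ * u θ * weakDeriv v θ / speed ρ θ ^ 3
      = ∫ θ in (0 : ℝ)..Real.pi, ρ θ * dθ ρ θ * U θ * v' θ / speed ρ θ ^ 3 :=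
    integral_congr_arc (by
      filter_upwards [hu.ae_eq, hv.weakDeriv_ae_eq] with x h1 h2; rw [h1, h2])
  have e5 : ∫ θ in (0 : ℝ)..Real.pi,
        (dθ (dθ ρ) θ * ρ θ - dθ ρ θ ^ 2 - ρ θ ^ 2) / speed ρ θ ^ 3 * u θ * v θ
      = ∫ θ in (0 : ℝ)..Real.pi,
        (dθ (dθ ρ) θ * ρ θ - dθ ρ θ ^ 2 - ρ θ ^ 2) / speed ρ θ ^ 3 * U θ * V θ :=
    integral_congr_arc (by
      filter_upwards [hu.ae_eq, hv.ae_eq] with x h1 h2; rw [h1, h2])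
  rw [innerSigma, e1, e2, e3, e4, e5, bilin]
  simp only [← intervalIntegral.integral_const_mul]
  rw [← intervalIntegral.integral_add (i1.const_mul g) (i2.const_mul σ),
    ← intervalIntegral.integral_sub ((i1.const_mul g).add (i2.const_mul σ)) (i3.const_mul σ),
    ← intervalIntegral.integral_sub (((i1.const_mul g).add (i2.const_mul σ)).sub (i3.const_mul σ))
      (i4.const_mul σ),
    ← intervalIntegral.integral_add ((((i1.const_mul g).add (i2.const_mul σ)).sub
      (i3.const_mul σ)).sub (i4.const_mul σ)) (i5.const_mul σ)]
  refine intervalIntegral.integral_congr fun x _ => ?_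
  simp only [Profile.coefA, Profile.coefB, Profile.coefD]
  ring

lemma isRep_shift : IsRep (shift ρ) (shift ρ) (Profile.shiftX' ρ (dθ ρ) (dθ (dθ ρ))) :=
  IsRep.of_hasDerivWithinAt (fun _ hθ => hp.shiftX_deriv hθ) hp.shiftX'_cont

lemma isRep_profile : IsRep ρ ρ (dθ ρ) := IsRep.of_hasDerivWithinAt hp.hasDeriv hp.cont₁

/-- Shifts are in the kernel of the second variation. -/
lemma innerSigma_shift (hu : MemH1 u) : innerSigma g σ ρ u (shift ρ) = 0 := by
  obtain ⟨U, hU⟩ := hu.exists_isRep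
  rw [innerSigma_eq_bilin hp hU (isRep_shift hp)]
  exact hp.bilin_shiftX hU.ac

lemma exists_coercive_innerSigma : ∃ δ > 0, ∀ w : ℝ → ℝ, MemH1 w →
    ∫ θ in (0 : ℝ)..Real.pi, w θ * ρ θ = 0 → ∫ θ in (0 : ℝ)..Real.pi, w θ * shift ρ θ = 0 →
    δ * normH1 w ^ 2 ≤ innerSigma g σ ρ w w := by
  obtain ⟨δ, hδ, h⟩ := hp.exists_coercive
  refine ⟨δ, hδ, fun w hw h1 h2 => ?_⟩
  obtain ⟨W, hW⟩ := hw.exists_isRep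
  rw [innerSigma_eq_bilin hp hW hW, hW.normH1_sq]
  refine (h W _ hW.ac hW.sq ?_ ?_).trans_eq ?_
  · exact (integral_congr_arc (by filter_upwards [hW.ae_eq] with x hx; rw [hx])).trans h1
  · exact (integral_congr_arc (by filter_upwards [hW.ae_eq] with x hx; rw [hx]; rfl)).trans h2
  · refine intervalIntegral.integral_congr fun x _ => ?_
    simp only [quadDensity]
    ring

/-- The shift preserves the area to first order. -/
lemma integral_profile_mul_shift : ∫ θ in (0 : ℝ)..Real.pi, ρ θ * shift ρ θ = 0 := by
  have y1 : HasACDeriv 0 Real.pi (Profile.height ρ)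
      (fun θ => dθ ρ θ * Real.sin θ + ρ θ * Real.cos θ) :=
    HasACDeriv.of_hasDerivWithinAt Real.pi_pos.le (fun θ hθ => hp.height_deriv hθ)
      ((hp.cont₁.mul Real.continuous_sin.continuousOn).add
        (hp.cont.mul Real.continuous_cos.continuousOn))
  have e := y1.integral_eq_sub
  rw [Profile.height_zero, Profile.height_pi, sub_zero] at e
  refine Eq.trans (intervalIntegral.integral_congr fun θ hθ => ?_) e
  have := (hp.pos θ (uIcc_zero_pi ▸ hθ)).ne'
  simp only [shift]
  field_simp
  ring

end

/-! ### Norms, and the constraints differentiated in time -/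

/-- `‖u - a v‖² ≥ ‖u‖² / 2 - a² ‖v‖²` in `H¹(0, π)`. -/
lemma normH1_sub_const_mul_sq_ge {u U u' v V v' : ℝ → ℝ} (hu : IsRep u U u') (hv : IsRep v V v')
    (a : ℝ) :
    normH1 u ^ 2 / 2 - a ^ 2 * normH1 v ^ 2 ≤ normH1 (fun x => u x - a * v x) ^ 2 := by
  have hw := hu.sub_const_mul hv a
  have part : ∀ F G : ℝ → ℝ, IntervalIntegrable (fun x => F x ^ 2) volume 0 Real.pi →
      IntervalIntegrable (fun x => G x ^ 2) volume 0 Real.pi →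
      IntervalIntegrable (fun x => (F x - a * G x) ^ 2) volume 0 Real.pi →
      (∫ x in (0 : ℝ)..Real.pi, F x ^ 2) / 2 - a ^ 2 * (∫ x in (0 : ℝ)..Real.pi, G x ^ 2)
        ≤ ∫ x in (0 : ℝ)..Real.pi, (F x - a * G x) ^ 2 := by
    intro F G hF hG hFG
    rw [← intervalIntegral.integral_const_mul, ← intervalIntegral.integral_div,
      ← intervalIntegral.integral_sub (hF.div_const 2) (hG.const_mul _)]
    refine intervalIntegral.integral_mono_on Real.pi_pos.le
      ((hF.div_const 2).sub (hG.const_mul _)) hFG fun x _ => ?_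
    nlinarith [sq_nonneg (F x - 2 * a * G x)]
  have p1 := part U V (hu.ac.continuousOn.pow 2).intervalIntegrable
    (hv.ac.continuousOn.pow 2).intervalIntegrable (hw.ac.continuousOn.pow 2).intervalIntegrable
  have p2 := part u' v' hu.sq hv.sq hw.sq
  rw [hu.normH1_sq, hv.normH1_sq, hw.normH1_sq]
  linarith

lemma normL2_sq (u : ℝ → ℝ) : normL2 u ^ 2 = ∫ x in (0 : ℝ)..Real.pi, u x ^ 2 :=
  Real.sq_sqrt (intervalIntegral.integral_nonneg Real.pi_pos.le fun _ _ => sq_nonneg _)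

lemma normL2_sq_le_normH1_sq (u : ℝ → ℝ) : normL2 u ^ 2 ≤ normH1 u ^ 2 := by
  have h1 : 0 ≤ ∫ x in (0 : ℝ)..Real.pi, u x ^ 2 :=
    intervalIntegral.integral_nonneg Real.pi_pos.le fun _ _ => sq_nonneg _
  have h2 : 0 ≤ ∫ x in (0 : ℝ)..Real.pi, weakDeriv u x ^ 2 :=
    intervalIntegral.integral_nonneg Real.pi_pos.le fun _ _ => sq_nonneg _
  rw [normL2_sq, normH1, Real.sq_sqrt (add_nonneg h1 h2)]
  linarith

lemma inner_L2Arc (f k : L2Arc) :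
    inner ℝ f k = ∫ θ in (0 : ℝ)..Real.pi, f θ * k θ := by
  rw [L2.inner_def, integral_arc]
  refine intervalIntegral.integral_congr fun x _ => ?_
  simp [mul_comm]

lemma norm_L2Arc (f : L2Arc) : ‖f‖ = normL2 f := by
  rw [normL2, norm_eq_sqrt_real_inner, inner_L2Arc]
  simp only [sq]

lemma inner_toLp {v : ℝ → ℝ} (hv : MemLp v 2 arc) (f : L2Arc) :
    inner ℝ f (hv.toLp v) = ∫ θ in (0 : ℝ)..Real.pi, f θ * v θ := by
  rw [inner_L2Arc]
  exact integral_congr_arc (by filter_upwards [hv.coeFn_toLp] with x hx; rw [hx])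

lemma HasDerivAt.eq_zero_of_eqOn {φ : ℝ → ℝ} {d t T : ℝ} (h : HasDerivAt φ d t)
    (ht : t ∈ Ioo 0 T) (h0 : ∀ τ ∈ Ioo 0 T, φ τ = 0) : d = 0 := by
  have e : (fun _ : ℝ => (0 : ℝ)) =ᶠ[𝓝 t] φ := by
    filter_upwards [Ioo_mem_nhds ht.1 ht.2] with τ hτ
    exact (h0 τ hτ).symm
  exact (h.congr_of_eventuallyEq e).unique (hasDerivAt_const t 0)

lemma timeDeriv_zero (ξ : ℝ → L2Arc) (t : ℝ) : timeDeriv 0 ξ t = ξ t := by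
  simp [timeDeriv]

lemma timeDeriv_one (ξ : ℝ → L2Arc) (t : ℝ) : timeDeriv 1 ξ t = deriv ξ t := by
  rw [timeDeriv, iteratedDeriv_one]

lemma timeDeriv_two (ξ : ℝ → L2Arc) (t : ℝ) : timeDeriv 2 ξ t = deriv (deriv ξ) t := by
  rw [timeDeriv, iteratedDeriv_succ, iteratedDeriv_one]

section

variable {ρ : ℝ → ℝ} {V T : ℝ} {ξ : ℝ → L2Arc} (h : IsPerturbation ρ V T ξ) {t : ℝ}
  (ht : t ∈ Ioo 0 T)
include h ht

/-- The shift does not depend on time, so the vanishing inner product with it can be differentiated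
twice. -/
lemma IsPerturbation.orthogonal_timeDeriv (hs : MemLp (shift ρ) 2 arc) (i : Fin 3) :
    ∫ θ in (0 : ℝ)..Real.pi, timeDeriv i ξ t θ * shift ρ θ = 0 := by
  have h0 : ∀ τ ∈ Ioo 0 T, inner ℝ (ξ τ) (hs.toLp _) = 0 := fun τ hτ => by
    rw [inner_toLp]; exact h.orthogonal τ hτ
  have h1 : ∀ τ ∈ Ioo 0 T, inner ℝ (deriv ξ τ) (hs.toLp _) = 0 := fun τ hτ => by
    have d := (h.differentiableAt τ hτ).hasDerivAt.inner ℝ (hasDerivAt_const τ (hs.toLp _))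
    simpa using HasDerivAt.eq_zero_of_eqOn d hτ h0
  have h2 : ∀ τ ∈ Ioo 0 T, inner ℝ (deriv (deriv ξ) τ) (hs.toLp _) = 0 := fun τ hτ => by
    have d := (h.differentiableAt_deriv τ hτ).hasDerivAt.inner ℝ (hasDerivAt_const τ (hs.toLp _))
    simpa using HasDerivAt.eq_zero_of_eqOn d hτ h1
  fin_cases i
  · change ∫ θ in (0 : ℝ)..Real.pi, timeDeriv 0 ξ t θ * shift ρ θ = 0
    rw [timeDeriv_zero, ← inner_toLp hs, h0 t ht]
  · change ∫ θ in (0 : ℝ)..Real.pi, timeDeriv 1 ξ t θ * shift ρ θ = 0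
    rw [timeDeriv_one, ← inner_toLp hs, h1 t ht]
  · change ∫ θ in (0 : ℝ)..Real.pi, timeDeriv 2 ξ t θ * shift ρ θ = 0
    rw [timeDeriv_two, ← inner_toLp hs, h2 t ht]

/-- Volume conservation reads 2⟨ξ, ρ⟩ + ⟨ξ, ξ⟩ = 0; this and its first two time derivatives are the
three cases. Thus aᵢ is the coefficient of the L² projection of ∂ₜⁱξ onto ρ. -/
lemma IsPerturbation.integral_timeDeriv_mul (hρ : MemLp ρ 2 arc)
    (hV : ∫ θ in (0 : ℝ)..Real.pi, ρ θ ^ 2 = V) (hV0 : V ≠ 0) (i : Fin 3) :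
    ∫ θ in (0 : ℝ)..Real.pi, timeDeriv i ξ t θ * ρ θ
      = aCoef ρ ξ t i * ∫ θ in (0 : ℝ)..Real.pi, ρ θ ^ 2 := by
  set R : L2Arc := hρ.toLp ρ with hR
  have h0 : ∀ τ ∈ Ioo 0 T, 2 * inner ℝ (ξ τ) R + inner ℝ (ξ τ) (ξ τ) = 0 := fun τ hτ => by
    have e := h.volume_eq τ hτ
    have l1 : IntervalIntegrable (fun θ => ρ θ ^ 2) volume 0 Real.pi :=
      intervalIntegrable_iff_arc.2 hρ.integrable_sq
    have l2 : IntervalIntegrable (fun θ => ξ τ θ * ξ τ θ) volume 0 Real.pi :=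
      intervalIntegrable_iff_arc.2 ((Lp.memLp (ξ τ)).integrable_mul (Lp.memLp (ξ τ)))
    have l3 : IntervalIntegrable (fun θ => ξ τ θ * ρ θ) volume 0 Real.pi :=
      intervalIntegrable_iff_arc.2 ((Lp.memLp (ξ τ)).integrable_mul hρ)
    have e2 : ∫ θ in (0 : ℝ)..Real.pi, (ρ θ + ξ τ θ) ^ 2 = ∫ θ in (0 : ℝ)..Real.pi,
        (ρ θ ^ 2 + (2 * (ξ τ θ * ρ θ) + ξ τ θ * ξ τ θ)) :=
      intervalIntegral.integral_congr fun θ _ => by ring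
    rw [e2, intervalIntegral.integral_add l1 ((l3.const_mul 2).add l2),
      intervalIntegral.integral_add (l3.const_mul 2) l2, intervalIntegral.integral_const_mul,
      hV, ← inner_toLp hρ, ← inner_L2Arc] at e
    linarith
  have h1 : ∀ τ ∈ Ioo 0 T, inner ℝ (deriv ξ τ) R + inner ℝ (ξ τ) (deriv ξ τ) = 0 :=
    fun τ hτ => by
      have d0 := (h.differentiableAt τ hτ).hasDerivAt
      have d := ((d0.inner ℝ (hasDerivAt_const τ R)).const_mul 2).fun_add (d0.inner ℝ d0)
      have e := HasDerivAt.eq_zero_of_eqOn d hτ h0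
      rw [inner_zero_right, zero_add, real_inner_comm (ξ τ) (deriv ξ τ)] at e
      linarith
  have h2 : inner ℝ (deriv (deriv ξ) t) R + (inner ℝ (ξ t) (deriv (deriv ξ) t)
      + inner ℝ (deriv ξ t) (deriv ξ t)) = 0 := by
    have d0 := (h.differentiableAt t ht).hasDerivAt
    have d1 := (h.differentiableAt_deriv t ht).hasDerivAt
    have d := (d1.inner ℝ (hasDerivAt_const t R)).fun_add (d0.inner ℝ d1)
    have e := HasDerivAt.eq_zero_of_eqOn d ht h1
    rwa [inner_zero_right, zero_add] at e
  have hV1 := hV0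
  rw [← hV] at hV1
  fin_cases i
  · change ∫ θ in (0 : ℝ)..Real.pi, timeDeriv 0 ξ t θ * ρ θ = _
    have e := h0 t ht
    simp only [aCoef, Matrix.cons_val_zero, Fin.zero_eta]
    rw [div_mul_cancel₀ _ hV1, timeDeriv_zero, ← inner_toLp hρ]
    rw [inner_L2Arc (ξ t) (ξ t)] at e
    simp only [sq]
    linarith
  · change ∫ θ in (0 : ℝ)..Real.pi, timeDeriv 1 ξ t θ * ρ θ = _
    have e := h1 t ht
    simp only [aCoef, Matrix.cons_val_one, Matrix.cons_val_zero, Fin.mk_one]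
    rw [div_mul_cancel₀ _ hV1, timeDeriv_one, ← inner_toLp hρ, ← inner_L2Arc]
    linarith
  · change ∫ θ in (0 : ℝ)..Real.pi, timeDeriv 2 ξ t θ * ρ θ
      = (-(∫ θ in (0 : ℝ)..Real.pi, timeDeriv 1 ξ t θ ^ 2)
        - ∫ θ in (0 : ℝ)..Real.pi, timeDeriv 2 ξ t θ * ξ t θ)
        / (∫ θ in (0 : ℝ)..Real.pi, ρ θ ^ 2) * ∫ θ in (0 : ℝ)..Real.pi, ρ θ ^ 2
    rw [div_mul_cancel₀ _ hV1, timeDeriv_two, timeDeriv_one, ← inner_toLp hρ, ← inner_L2Arc]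
    rw [inner_L2Arc (deriv ξ t), real_inner_comm (deriv (deriv ξ) t) (ξ t)] at h2
    simp only [sq]
    linarith

end

end SessileDrop

/-! ### The coercivity estimates for perturbations -/

theorem mainTheorem4 (g σ γ V P₀ : ℝ) (hg : 0 < g) (hσ : 0 < σ) (hγ : |γ| < σ)
    (ρ₀ : ℝ → ℝ) (hρ₀ : IsEquilibrium g σ γ V P₀ ρ₀) :
    ∃ δ > 0, ∃ δ₁ > 0, ∃ δ₂ > 0, ∃ δ₃ > 0, ∃ ε > 0,
      (∀ w : ℝ → ℝ, MemH1 w →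
        ∫ θ in (0 : ℝ)..Real.pi, w θ * ρ₀ θ = 0 →
        ∫ θ in (0 : ℝ)..Real.pi, w θ * shift ρ₀ θ = 0 →
        innerSigma g σ ρ₀ w w ≥ δ * normH1 w ^ 2) ∧
      (∀ (T : ℝ) (ξ : ℝ → L2Arc), IsPerturbation ρ₀ V T ξ →
        (∀ t ∈ Set.Ioo 0 T, ∑ i : Fin 3, normH1 (timeDeriv i ξ t) ^ 2 ≤ ε) →
        ∀ t ∈ Set.Ioo 0 T,
          (∀ i : Fin 3, innerSigma g σ ρ₀ (corrected ρ₀ ξ i t) (shift ρ₀) = 0) ∧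
          (∀ i : Fin 3, innerSigma g σ ρ₀ (corrected ρ₀ ξ i t) (corrected ρ₀ ξ i t)
            ≥ δ * normH1 (corrected ρ₀ ξ i t) ^ 2) ∧
          innerSigma g σ ρ₀ (corrected ρ₀ ξ 0 t) (corrected ρ₀ ξ 0 t)
            ≥ δ * normH1 (ξ t) ^ 2 - normL2 (ξ t) ^ 4 ∧
          innerSigma g σ ρ₀ (corrected ρ₀ ξ 1 t) (corrected ρ₀ ξ 1 t)
            ≥ δ₁ * normH1 (timeDeriv 1 ξ t) ^ 2 - δ₂ * normL2 (ξ t) ^ 4 ∧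
          innerSigma g σ ρ₀ (corrected ρ₀ ξ 2 t) (corrected ρ₀ ξ 2 t)
            ≥ δ₁ * normH1 (timeDeriv 2 ξ t) ^ 2 - δ₂ * normL2 (timeDeriv 1 ξ t) ^ 4
              - δ₃ * normL2 (timeDeriv 2 ξ t) ^ 2 * normL2 (ξ t) ^ 2) := by
  have hp := hρ₀.profile hg hσ hγ
  have hVol := hρ₀.volume_eq
  have hV : 0 < V := by
    rw [← hVol]
    exact intervalIntegral.intervalIntegral_pos_of_pos_on
      (ContinuousOn.intervalIntegrable (uIcc_zero_pi ▸ hp.cont.pow 2))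
      (fun θ hθ => pow_pos (hp.pos θ (Set.Ioo_subset_Icc_self hθ)) 2) Real.pi_pos
  obtain ⟨κ, hκ, coer⟩ := exists_coercive_innerSigma hp
  have repρ := isRep_profile hp
  have repS := isRep_shift hp
  set B := normH1 ρ₀ ^ 2 / V ^ 2 with hB
  have hB0 : 0 ≤ B := by positivity
  -- The cap 1/(B + 1) gives δ₀ B ≤ 1, because the bound for ξ itself has coefficient 1 in front of
  -- the quartic term.
  set δ₀ := min κ (1 / (B + 1)) with hδ₀
  have hδ0 : 0 < δ₀ := lt_min hκ (by positivity)
  have hδκ : δ₀ ≤ κ := min_le_left _ _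
  have hδB : δ₀ * B ≤ 1 := by
    have h1 : δ₀ ≤ 1 / (B + 1) := min_le_right _ _
    rw [le_div_iff₀ (by positivity)] at h1
    nlinarith
  -- The half is the loss in ‖u - a v‖² ≥ ‖u‖²/2 - a²‖v‖², and a further quarter pays for the a₁
  -- term. The factor 2 in 2 B δ₀ comes from squaring the two-term bound for a₂, and the added 1
  -- secures positivity since only B ≥ 0 is recorded. The last constant is chosen so that B ‖ξ‖² ≤
  -- 1/4 in L².
  refine ⟨δ₀ / 2, by positivity, δ₀ / 4, by positivity, 2 * B * δ₀ + 1, by positivity,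
    2 * B * δ₀ + 1, by positivity, 1 / (4 * (B + 1)), by positivity, ?_, ?_⟩
  · intro w hw h1 h2
    have h3 := coer w hw h1 h2
    have h4 : δ₀ / 2 * normH1 w ^ 2 ≤ κ * normH1 w ^ 2 := by
      gcongr
      linarith
    linarith
  intro T ξ hξ hε t ht
  have hmem : ∀ i : Fin 3, MemH1 (timeDeriv i ξ t) := hξ.memH1 t ht
  have hcmem : ∀ i : Fin 3, MemH1 (corrected ρ₀ ξ i t) := by
    intro i
    obtain ⟨U, hU⟩ := (hmem i).exists_isRep
    exact (hU.sub_const_mul repρ (aCoef ρ₀ ξ t i)).memH1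
  have mulInt : ∀ (i : Fin 3) (v : ℝ → ℝ), MemLp v 2 arc →
      ∫ θ in (0 : ℝ)..Real.pi, corrected ρ₀ ξ i t θ * v θ
        = (∫ θ in (0 : ℝ)..Real.pi, timeDeriv i ξ t θ * v θ)
          - aCoef ρ₀ ξ t i * ∫ θ in (0 : ℝ)..Real.pi, ρ₀ θ * v θ := by
    intro i v hv
    have i1 : IntervalIntegrable (fun θ => timeDeriv i ξ t θ * v θ)
        MeasureTheory.volume 0 Real.pi :=
      intervalIntegrable_iff_arc.2 ((hmem i).1.integrable_mul hv)
    have i2 : IntervalIntegrable (fun θ => ρ₀ θ * v θ) MeasureTheory.volume 0 Real.pi :=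
      intervalIntegrable_iff_arc.2 (repρ.memLp.integrable_mul hv)
    rw [← intervalIntegral.integral_const_mul,
      ← intervalIntegral.integral_sub i1 (i2.const_mul _)]
    exact intervalIntegral.integral_congr fun θ _ => by simp only [corrected]; ring
  have hc1 : ∀ i : Fin 3, ∫ θ in (0 : ℝ)..Real.pi, corrected ρ₀ ξ i t θ * ρ₀ θ = 0 := by
    intro i
    rw [mulInt i ρ₀ repρ.memLp, hξ.integral_timeDeriv_mul ht repρ.memLp hVol hV.ne' i]
    simp only [sq, sub_self]
  have hc2 : ∀ i : Fin 3, ∫ θ in (0 : ℝ)..Real.pi, corrected ρ₀ ξ i t θ * shift ρ₀ θ = 0 := by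
    intro i
    rw [mulInt i _ repS.memLp, hξ.orthogonal_timeDeriv ht repS.memLp i,
      integral_profile_mul_shift hp, mul_zero, sub_zero]
  have hcoer : ∀ i : Fin 3, κ * normH1 (corrected ρ₀ ξ i t) ^ 2
      ≤ innerSigma g σ ρ₀ (corrected ρ₀ ξ i t) (corrected ρ₀ ξ i t) :=
    fun i => coer _ (hcmem i) (hc1 i) (hc2 i)
  have hlow : ∀ i : Fin 3, δ₀ * (normH1 (timeDeriv i ξ t) ^ 2 / 2
      - aCoef ρ₀ ξ t i ^ 2 * normH1 ρ₀ ^ 2)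
      ≤ innerSigma g σ ρ₀ (corrected ρ₀ ξ i t) (corrected ρ₀ ξ i t) := by
    intro i
    obtain ⟨U, hU⟩ := (hmem i).exists_isRep
    have h1 := normH1_sub_const_mul_sq_ge hU repρ (aCoef ρ₀ ξ t i)
    calc _ ≤ δ₀ * normH1 (corrected ρ₀ ξ i t) ^ 2 := by gcongr; exact h1
      _ ≤ κ * normH1 (corrected ρ₀ ξ i t) ^ 2 := by gcongr
      _ ≤ _ := hcoer i
  set n₀ := normL2 (ξ t) with hn₀
  set n₁ := normL2 (timeDeriv 1 ξ t) with hn₁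
  set n₂ := normL2 (timeDeriv 2 ξ t) with hn₂
  have p₀ : 0 ≤ n₀ := Real.sqrt_nonneg _
  have p₁ : 0 ≤ n₁ := Real.sqrt_nonneg _
  have p₂ : 0 ≤ n₂ := Real.sqrt_nonneg _
  have a₀ : aCoef ρ₀ ξ t 0 = -(1 / 2) * n₀ ^ 2 / V := by
    rw [hn₀, normL2_sq, ← hVol]
    rfl
  have a₁ : |aCoef ρ₀ ξ t 1| ≤ n₀ * n₁ / V := by
    have e : aCoef ρ₀ ξ t 1
        = (-∫ θ in (0 : ℝ)..Real.pi, ξ t θ * timeDeriv 1 ξ t θ) / V := by rw [← hVol]; rfl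
    rw [e, timeDeriv_one, ← inner_L2Arc, abs_div, abs_neg, abs_of_pos hV, hn₀, hn₁, timeDeriv_one,
      ← norm_L2Arc, ← norm_L2Arc]
    gcongr
    exact abs_real_inner_le_norm _ _
  have a₂ : |aCoef ρ₀ ξ t 2| ≤ (n₁ ^ 2 + n₂ * n₀) / V := by
    have e : aCoef ρ₀ ξ t 2 = (-(∫ θ in (0 : ℝ)..Real.pi, timeDeriv 1 ξ t θ ^ 2)
        - ∫ θ in (0 : ℝ)..Real.pi, timeDeriv 2 ξ t θ * ξ t θ) / V := by rw [← hVol]; rfl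
    rw [e, ← normL2_sq, ← hn₁, abs_div, abs_of_pos hV]
    have h1 : |∫ θ in (0 : ℝ)..Real.pi, timeDeriv 2 ξ t θ * ξ t θ| ≤ n₂ * n₀ := by
      rw [hn₂, hn₀, timeDeriv_two, ← inner_L2Arc, ← norm_L2Arc, ← norm_L2Arc]
      exact abs_real_inner_le_norm _ _
    gcongr
    rw [abs_le] at h1 ⊢
    constructor <;> nlinarith
  have hεt := hε t ht
  rw [Fin.sum_univ_three] at hεt
  have hε₀ : n₀ ^ 2 ≤ 1 / (4 * (B + 1)) := by
    have h1 := normL2_sq_le_normH1_sq (timeDeriv 0 ξ t)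
    rw [timeDeriv_zero] at h1
    have h2 : normH1 (timeDeriv ((0 : Fin 3) : ℕ) ξ t) ^ 2 = normH1 (ξ t) ^ 2 := by
      rw [Fin.val_zero, timeDeriv_zero]
    rw [h2] at hεt
    linarith [sq_nonneg (normH1 (timeDeriv ((1 : Fin 3) : ℕ) ξ t)),
      sq_nonneg (normH1 (timeDeriv ((2 : Fin 3) : ℕ) ξ t))]
  refine ⟨fun i => innerSigma_shift hp (hcmem i), fun i => ?_, ?_, ?_, ?_⟩
  · refine le_trans ?_ (hcoer i)
    gcongr
    linarith
  · have h1 : δ₀ * (normH1 (timeDeriv 0 ξ t) ^ 2 / 2 - aCoef ρ₀ ξ t 0 ^ 2 * normH1 ρ₀ ^ 2)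
      ≤ _ := hlow 0
    rw [timeDeriv_zero, a₀] at h1
    have h2 : (-(1 / 2) * n₀ ^ 2 / V) ^ 2 * normH1 ρ₀ ^ 2 = n₀ ^ 4 * B / 4 := by
      rw [hB]; field_simp; ring
    rw [h2] at h1
    have h3 : δ₀ * B * n₀ ^ 4 ≤ 1 * n₀ ^ 4 := by gcongr
    have h4 : 0 ≤ n₀ ^ 4 := by positivity
    linarith
  · have h1 : δ₀ * (normH1 (timeDeriv 1 ξ t) ^ 2 / 2 - aCoef ρ₀ ξ t 1 ^ 2 * normH1 ρ₀ ^ 2)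
      ≤ _ := hlow 1
    have h2 : aCoef ρ₀ ξ t 1 ^ 2 * normH1 ρ₀ ^ 2 ≤ B * n₀ ^ 2 * n₁ ^ 2 := by
      calc aCoef ρ₀ ξ t 1 ^ 2 * normH1 ρ₀ ^ 2 = |aCoef ρ₀ ξ t 1| ^ 2 * normH1 ρ₀ ^ 2 := by
            rw [sq_abs]
        _ ≤ (n₀ * n₁ / V) ^ 2 * normH1 ρ₀ ^ 2 := by gcongr
        _ = _ := by rw [hB]; field_simp
    -- The smallness of ξ enters only here: the bound for a₁² contains ‖∂ₜξ‖² with a small factor,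
    -- which is absorbed by the left-hand side.
    have h3 : B * n₀ ^ 2 ≤ 1 / 4 := by
      calc B * n₀ ^ 2 ≤ (B + 1) * (1 / (4 * (B + 1))) := by
            gcongr
            linarith
        _ = 1 / 4 := by field_simp
    have h4 : B * n₀ ^ 2 * n₁ ^ 2 ≤ 1 / 4 * normH1 (timeDeriv 1 ξ t) ^ 2 :=
      mul_le_mul h3 (normL2_sq_le_normH1_sq _) (sq_nonneg _) (by norm_num)
    have h5 : δ₀ * (normH1 (timeDeriv 1 ξ t) ^ 2 / 4)
        ≤ δ₀ * (normH1 (timeDeriv 1 ξ t) ^ 2 / 2 - aCoef ρ₀ ξ t 1 ^ 2 * normH1 ρ₀ ^ 2) := by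
      gcongr
      linarith
    have h6 : 0 ≤ (2 * B * δ₀ + 1) * n₀ ^ 4 := by positivity
    linarith
  · have h1 : δ₀ * (normH1 (timeDeriv 2 ξ t) ^ 2 / 2 - aCoef ρ₀ ξ t 2 ^ 2 * normH1 ρ₀ ^ 2)
      ≤ _ := hlow 2
    -- Here nothing is absorbed: both parts of the bound for a₂² are kept as the error terms with δ₂
    -- and δ₃.
    have h2 : aCoef ρ₀ ξ t 2 ^ 2 * normH1 ρ₀ ^ 2 ≤ B * (2 * (n₁ ^ 4 + n₂ ^ 2 * n₀ ^ 2)) := by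
      calc aCoef ρ₀ ξ t 2 ^ 2 * normH1 ρ₀ ^ 2 = |aCoef ρ₀ ξ t 2| ^ 2 * normH1 ρ₀ ^ 2 := by
            rw [sq_abs]
        _ ≤ ((n₁ ^ 2 + n₂ * n₀) / V) ^ 2 * normH1 ρ₀ ^ 2 := by gcongr
        _ = B * (n₁ ^ 2 + n₂ * n₀) ^ 2 := by rw [hB]; field_simp
        _ ≤ _ := by
          gcongr
          nlinarith [sq_nonneg (n₁ ^ 2 - n₂ * n₀)]
    have h3 : δ₀ * (normH1 (timeDeriv 2 ξ t) ^ 2 / 2 - B * (2 * (n₁ ^ 4 + n₂ ^ 2 * n₀ ^ 2)))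
        ≤ δ₀ * (normH1 (timeDeriv 2 ξ t) ^ 2 / 2 - aCoef ρ₀ ξ t 2 ^ 2 * normH1 ρ₀ ^ 2) := by
      gcongr
    have h4 : 0 ≤ n₁ ^ 4 := by positivity
    have h5 : 0 ≤ n₂ ^ 2 * n₀ ^ 2 := by positivity
    have h6 : 0 ≤ δ₀ * normH1 (timeDeriv 2 ξ t) ^ 2 := by positivity
    linarith
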